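/- Let $n\ge 2$, let $p\ge n$ be real, let $K\subset\mathbb{R}^n$ be a nonempty compact set, and let $\mathcal{A}$ be a vector field satisfying, for some constants $\gamma,\Gamma>0$: (v) $\mathcal{A}\in C(\overline{\mathbb{R}^n\setminus K}\times\mathbb{R}^n;\mathbb{R}^n)\cap C^1(\overline{\mathbb{R}^n\setminus K}\times(\mathbb{R}^n\setminus\{0\});\mathbb{R}^n)$, where $C^1$ up to the closure means that $\mathcal{A}$ is $C^1$ on $(\mathbb{R}^n\setminus K)\times(\mathbb{R}^n\setminus\{0\})$ and its first derivatives extend continuously to $\overline{\mathbb{R}^n\setminus K}\times(\mathbb{R}^n\setminus\{0\})$; (vi) $\mathcal{A}(x,0)=0$ for $x\in\mathbb{R}^n\setminus K$; (vii) $\sum_{i,j=1}^n\left|\frac{\partial\mathcal{A}_j(x,\eta)}{\partial\eta_i}\right|\le\Gamma|\eta|^{p-2}$ for $x\in\mathbb{R}^n\setminus K$ and $\eta\in\mathbb{R}^n\setminus\{0\}$; (viii) $\sum_{i,j=1}^n\frac{\partial\mathcal{A}_j(x,\eta)}{\partial\eta_i}\,\xi_i\xi_j\ge\gamma|\xi|^2|\eta|^{p-2}$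 for $x\in\mathbb{R}^n\setminus K$, $\eta\in\mathbb{R}^n\setminus\{0\}$ and $\xi\in\mathbb{R}^n$. Let $f_1,f_2$ be real functions on $\mathbb{R}^n\setminus K$ such that $f_1,f_2\in L^1(\mathbb{R}^n\setminus U)$ for every open set $U\supset K$, and $f_1\le f_2$ almost everywhere in $\mathbb{R}^n\setminus K$. Let $u,v\in C^0(\overline{\mathbb{R}^n\setminus K})\cap W^{1,p}_{\mathrm{loc}}(\mathbb{R}^n\setminus K)\cap L^\infty(\mathbb{R}^n\setminus K)$ satisfy $$-\operatorname{div}\mathcal{A}(x,\nabla u)=f_1,\qquad -\operatorname{div}\mathcal{A}(x,\nabla v)=f_2\qquad\text{in }\mathbb{R}^n\setminus K$$ in the weak sense, i.e. $\int_{\mathbb{R}^n\setminus K}\mathcal{A}(x,\nabla u)\cdot\nabla\varphi\,dx=\int_{\mathbb{R}^n\setminus K}f_1\varphi\,dx$ for all $\varphi\in C_c^\infty(\mathbb{R}^n\setminus K)$, and likewise for $v$ and $f_2$. If $v\ge u$ on $\partial K$, then $v\ge u$ in $\mathbb{R}^n\setminus K$. -/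

import Mathlib

open MeasureTheory Set
open scoped ContDiff Gradient

namespace ExteriorComparison

/-- `φ ∈ C_c^∞(Ω)`. -/
structure IsTestFunction {n : ℕ} (Ω : Set (EuclideanSpace ℝ (Fin n)))
    (φ : EuclideanSpace ℝ (Fin n) → ℝ) : Prop where
  smooth : ContDiff ℝ ∞ φ
  compact_support : HasCompactSupport φ
  support_subset : tsupport φ ⊆ Ω

/-- `g ∈ L^p_loc(Ω)`: `g` is in `L^p` of every compact subset of `Ω`. -/
def MemLpLoc {n : ℕ} {F : Type*} [NormedAddCommGroup F]
    (Ω : Set (EuclideanSpace ℝ (Fin n))) (p : ℝ)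
    (g : EuclideanSpace ℝ (Fin n) → F) : Prop :=
  ∀ C : Set (EuclideanSpace ℝ (Fin n)), IsCompact C → C ⊆ Ω →
    MemLp g (ENNReal.ofReal p) (volume.restrict C)

/-- `G` is a weak (distributional) gradient of `u` in the open set `Ω`. -/
structure HasWeakGradient {n : ℕ} (Ω : Set (EuclideanSpace ℝ (Fin n)))
    (u : EuclideanSpace ℝ (Fin n) → ℝ)
    (G : EuclideanSpace ℝ (Fin n) → EuclideanSpace ℝ (Fin n)) : Prop where
  locallyIntegrable : LocallyIntegrableOn u Ω volume
  locallyIntegrable_grad : LocallyIntegrableOn G Ω volume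
  integral_eq : ∀ φ : EuclideanSpace ℝ (Fin n) → ℝ, IsTestFunction Ω φ →
    ∫ x in Ω, u x • ∇ φ x = - ∫ x in Ω, φ x • G x

/-- `u ∈ W^{1,p}_loc(Ω)`. -/
def MemW1pLoc {n : ℕ} (Ω : Set (EuclideanSpace ℝ (Fin n))) (p : ℝ)
    (u : EuclideanSpace ℝ (Fin n) → ℝ) : Prop :=
  MemLpLoc Ω p u ∧
    ∃ G : EuclideanSpace ℝ (Fin n) → EuclideanSpace ℝ (Fin n),
      HasWeakGradient Ω u G ∧ MemLpLoc Ω p G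

/-- `-div 𝒜(x, ∇u) = f` in `Ω` in the weak sense. The weak gradient `G = ∇u` is unique up to
a null set, so the choice of `G` does not matter. -/
def IsWeakSolution {n : ℕ} (Ω : Set (EuclideanSpace ℝ (Fin n)))
    (A : EuclideanSpace ℝ (Fin n) → EuclideanSpace ℝ (Fin n) → EuclideanSpace ℝ (Fin n))
    (u f : EuclideanSpace ℝ (Fin n) → ℝ) : Prop :=
  ∃ G : EuclideanSpace ℝ (Fin n) → EuclideanSpace ℝ (Fin n), HasWeakGradient Ω u G ∧
    ∀ φ : EuclideanSpace ℝ (Fin n) → ℝ, IsTestFunction Ω φ →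
      IntegrableOn (fun x => inner ℝ (A x (G x)) (∇ φ x)) Ω volume ∧
      IntegrableOn (fun x => f x * φ x) Ω volume ∧
      ∫ x in Ω, inner ℝ (A x (G x)) (∇ φ x) = ∫ x in Ω, f x * φ x

/-- The partial derivative `∂𝒜_j(x, η) / ∂η_i`. -/
noncomputable def partialEta {n : ℕ}
    (A : EuclideanSpace ℝ (Fin n) → EuclideanSpace ℝ (Fin n) → EuclideanSpace ℝ (Fin n))
    (x η : EuclideanSpace ℝ (Fin n)) (i j : Fin n) : ℝ :=
  (fderiv ℝ (A x) η (EuclideanSpace.single i (1 : ℝ))) j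

/-- The structure conditions on the vector field `𝒜` over the exterior of `K`.
The field `contDiff` says that `𝒜` is `C^1` on `(ℝⁿ ∖ K) × (ℝⁿ ∖ {0})` and that its first
derivative extends continuously to `closure (ℝⁿ ∖ K) × (ℝⁿ ∖ {0})`. -/
structure StructureConditions {n : ℕ} (K : Set (EuclideanSpace ℝ (Fin n))) (p : ℝ)
    (A : EuclideanSpace ℝ (Fin n) → EuclideanSpace ℝ (Fin n) → EuclideanSpace ℝ (Fin n)) :
    Prop where
  continuousOn : ContinuousOn (Function.uncurry A) (closure Kᶜ ×ˢ univ)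
  contDiff : ∃ D : EuclideanSpace ℝ (Fin n) × EuclideanSpace ℝ (Fin n) →
      (EuclideanSpace ℝ (Fin n) × EuclideanSpace ℝ (Fin n) →L[ℝ] EuclideanSpace ℝ (Fin n)),
    ContinuousOn D (closure Kᶜ ×ˢ {0}ᶜ) ∧
      ∀ z ∈ Kᶜ ×ˢ {0}ᶜ, HasFDerivAt (Function.uncurry A) (D z) z
  map_zero : ∀ x ∈ Kᶜ, A x 0 = 0
  growth : ∃ Γ : ℝ, 0 < Γ ∧ ∀ x ∈ Kᶜ, ∀ η : EuclideanSpace ℝ (Fin n), η ≠ 0 →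
    ∑ i, ∑ j, |partialEta A x η i j| ≤ Γ * ‖η‖ ^ (p - 2)
  elliptic : ∃ γ : ℝ, 0 < γ ∧ ∀ x ∈ Kᶜ, ∀ η : EuclideanSpace ℝ (Fin n), η ≠ 0 →
    ∀ ξ : EuclideanSpace ℝ (Fin n),
      γ * ‖ξ‖ ^ 2 * ‖η‖ ^ (p - 2) ≤ ∑ i, ∑ j, partialEta A x η i j * ξ i * ξ j

end ExteriorComparison

/-! Suppose `u - v > ε > 0` at some point `x₀`. Continuity up to the boundary and `u ≤ v` on `∂K`
make `{u - v ≥ ε}` a closed set disjoint from `K`. Take `h` smooth, nondecreasing, with `0 ≤ h ≤ 1`,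
vanishing on `t ≤ ε` and positive beyond. Then `h(u - v)` vanishes near `K` and, multiplied by a
cutoff `η_R` equal to `1` on the ball of radius `R`, may be used to test both equations. Subtracting
them and using `f₁ ≤ f₂`, `∫ η_R h'(u - v) (𝒜(x,∇u) - 𝒜(x,∇v))·(∇u - ∇v) ≤ ∫ h(u - v) (𝒜(x,∇v) -
𝒜(x,∇u))·∇η_R`. The left integrand is nonnegative, so everything depends on the right side vanishing
as `R → ∞`.

Two facts give this. By scaling, `∫ |∇η_R|^p` equals `R^(n-p)` times a constant, hence stays bounded
because `p ≥ n`. And `|∇u|^p`, `|∇v|^p` are integrable near infinity, by a Caccioppoli estimate for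
bounded solutions (`exists_integrableOn_norm_gradient_rpow`). Young's inequality with weight `δ`
bounds the right side by `δ` times the energy of `u` and `v` outside the ball of radius `R`, plus a
multiple of `δ^(1-p)`. Letting `R → ∞` and then `δ → ∞` leaves zero.

Strict monotonicity of `𝒜` now gives `h'(u - v) (∇u - ∇v) = 0` almost everywhere
(`ae_deriv_smul_sub_eq_zero`). Hence `h(u - v)`, extended by zero across `K`, is continuous on all
of `ℝⁿ` with zero distributional gradient, so it is constant. It vanishes on the nonempty set `K`
and is positive at `x₀`, a contradiction. Working on the whole space makes connectedness of the
exterior irrelevant.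

The analytic tool is `testing_with_comp_mul`: mollification extends the weak formulation from smooth
test functions to products `h(w) Ψ` with `w` continuous and Sobolev. -/

namespace ExteriorComparison

open Filter Topology Metric Convolution

/-! ### Mollification in `L^p` -/

section Mollification

variable {E F : Type*} [NormedAddCommGroup E] [NormedSpace ℝ E] [FiniteDimensional ℝ E]
  [MeasurableSpace E] [BorelSpace E] [NormedAddCommGroup F] [NormedSpace ℝ F]
  {μ : Measure E} [μ.IsAddHaarMeasure]

/-- Convolution with a normalized bump function does not increase the `L^p` norm. -/
theorem eLpNorm_normed_convolution_le (φ : ContDiffBump (0 : E)) {p : ℝ} (hp : 1 ≤ p)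
    {g : E → F} (hg : AEStronglyMeasurable g μ) :
    eLpNorm (φ.normed μ ⋆[ContinuousLinearMap.lsmul ℝ ℝ, μ] g) (ENNReal.ofReal p) μ ≤
      eLpNorm g (ENNReal.ofReal p) μ := by
  have hp0 : 0 < p := by linarith
  have hρm : Measurable (fun t => ENNReal.ofReal (φ.normed μ t)) :=
    φ.continuous_normed.measurable.ennreal_ofReal
  have hρ1 : ∫⁻ t, ENNReal.ofReal (φ.normed μ t) ∂μ = 1 := by
    rw [← ofReal_integral_eq_lintegral_ofReal φ.integrable_normed
      (Eventually.of_forall φ.nonneg_normed), φ.integral_normed, ENNReal.ofReal_one]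
  -- The mollifier is a probability density, so Jensen's inequality for the power `p` becomes
  -- monotonicity of `L^p` norms in the exponent with respect to `ν`. Tonelli and translation
  -- invariance then finish the estimate.
  set ν := μ.withDensity (fun t => ENNReal.ofReal (φ.normed μ t)) with hν
  have : IsProbabilityMeasure ν := ⟨by rw [hν, withDensity_apply _ .univ]; simpa using hρ1⟩
  have hsub : ∀ x, AEStronglyMeasurable (fun t => g (x - t)) μ := fun x =>
    hg.comp_measurePreserving (Measure.measurePreserving_sub_left μ x)
  have hpt : ∀ x, ‖(φ.normed μ ⋆[ContinuousLinearMap.lsmul ℝ ℝ, μ] g) x‖ₑ ^ p ≤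
      ∫⁻ t, ENNReal.ofReal (φ.normed μ t) * ‖g (x - t)‖ₑ ^ p ∂μ := by
    intro x
    have h1 : ‖(φ.normed μ ⋆[ContinuousLinearMap.lsmul ℝ ℝ, μ] g) x‖ₑ ≤
        ∫⁻ t, ‖g (x - t)‖ₑ ∂ν := by
      rw [convolution_def, hν, lintegral_withDensity_eq_lintegral_mul₀ hρm.aemeasurable
        (hsub x).enorm]
      refine (enorm_integral_le_lintegral_enorm _).trans (lintegral_mono fun t => ?_)
      simp only [ContinuousLinearMap.lsmul_apply, enorm_smul, Pi.mul_apply]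
      rw [Real.enorm_eq_ofReal (φ.nonneg_normed t)]
    have h2 : ∫⁻ t, ‖g (x - t)‖ₑ ∂ν ≤ (∫⁻ t, ‖g (x - t)‖ₑ ^ p ∂ν) ^ (1 / p) := by
      have := eLpNorm_le_eLpNorm_of_exponent_le (μ := ν) (f := fun t => g (x - t)) (p := 1)
        (q := ENNReal.ofReal p) (by simpa using hp)
        ((hsub x).mono_ac (withDensity_absolutelyContinuous _ _))
      rwa [eLpNorm_one_eq_lintegral_enorm,
        eLpNorm_eq_lintegral_rpow_enorm_toReal (by simpa using hp0) (by simp),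
        ENNReal.toReal_ofReal hp0.le] at this
    calc _ ≤ ((∫⁻ t, ‖g (x - t)‖ₑ ^ p ∂ν) ^ (1 / p)) ^ p := by gcongr; exact h1.trans h2
      _ = ∫⁻ t, ‖g (x - t)‖ₑ ^ p ∂ν := by
        rw [← ENNReal.rpow_mul, one_div_mul_cancel hp0.ne', ENNReal.rpow_one]
      _ = _ := by
        rw [hν, lintegral_withDensity_eq_lintegral_mul₀ hρm.aemeasurable
          ((hsub x).enorm.pow_const p)]
        rfl
  rw [eLpNorm_eq_lintegral_rpow_enorm_toReal (by simpa using hp0) (by simp),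
    eLpNorm_eq_lintegral_rpow_enorm_toReal (by simpa using hp0) (by simp),
    ENNReal.toReal_ofReal hp0.le]
  refine ENNReal.rpow_le_rpow ?_ (by positivity)
  calc ∫⁻ x, ‖(φ.normed μ ⋆[ContinuousLinearMap.lsmul ℝ ℝ, μ] g) x‖ₑ ^ p ∂μ
      ≤ ∫⁻ x, ∫⁻ t, ENNReal.ofReal (φ.normed μ t) * ‖g (x - t)‖ₑ ^ p ∂μ ∂μ :=
        lintegral_mono hpt
    _ = ∫⁻ t, ∫⁻ x, ENNReal.ofReal (φ.normed μ t) * ‖g (x - t)‖ₑ ^ p ∂μ ∂μ := by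
        refine lintegral_lintegral_swap ?_
        have h := (hg.comp_quasiMeasurePreserving
          (quasiMeasurePreserving_sub_of_right_invariant μ μ)).enorm.pow_const p
        exact (hρm.comp measurable_snd).aemeasurable.mul h
    _ = ∫⁻ t, ENNReal.ofReal (φ.normed μ t) * ∫⁻ x, ‖g x‖ₑ ^ p ∂μ ∂μ := by
        refine lintegral_congr fun t => ?_
        rw [lintegral_const_mul' _ _ ENNReal.ofReal_ne_top,
          lintegral_sub_right_eq_self (fun x => ‖g x‖ₑ ^ p) t]
    _ = ∫⁻ x, ‖g x‖ₑ ^ p ∂μ := by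
        rw [lintegral_mul_const _ hρm, hρ1, one_mul]

/-- Mollifications of an `L^p` function converge to it in `L^p`. -/
theorem tendsto_eLpNorm_normed_convolution_sub [CompleteSpace F]
    {φ : ℕ → ContDiffBump (0 : E)} (hφ : Tendsto (fun k => (φ k).rOut) atTop (𝓝 0))
    {p : ℝ} (hp : 1 ≤ p) {g : E → F} (hg : MemLp g (ENNReal.ofReal p) μ) :
    Tendsto (fun k => eLpNorm
      ((φ k).normed μ ⋆[ContinuousLinearMap.lsmul ℝ ℝ, μ] g - g) (ENNReal.ofReal p) μ)
      atTop (𝓝 0) := by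
  have hp1 : 1 ≤ ENNReal.ofReal p := by simpa using hp
  have hloc : ∀ {f : E → F}, MemLp f (ENNReal.ofReal p) μ → LocallyIntegrable f μ :=
    fun hf => hf.locallyIntegrable hp1
  have hexist : ∀ k, ∀ {f : E → F}, MemLp f (ENNReal.ofReal p) μ →
      ConvolutionExists ((φ k).normed μ) f (ContinuousLinearMap.lsmul ℝ ℝ) μ := fun k f hf =>
    (φ k).hasCompactSupport_normed.convolutionExists_left _ (φ k).continuous_normed (hloc hf)
  rw [ENNReal.tendsto_nhds_zero]
  intro ε hε
  by_cases hεt : ε = ⊤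
  · simp [hεt]
  -- With `f` continuous of compact support and close to `g`, the three thirds pay for `ρ ⋆ (g -
  -- f)`, `ρ ⋆ f - f` and `f - g`; the first is controlled by the contraction property.
  obtain ⟨δ, hδ, hδε⟩ : ∃ δ : ENNReal, 0 < δ ∧ δ + δ + δ ≤ ε :=
    ⟨ε / 3, ENNReal.div_pos hε.ne' (by simp), by rw [ENNReal.add_thirds]⟩
  obtain ⟨f, hfc, hfε, hfcont, hfmem⟩ :=
    hg.exists_hasCompactSupport_eLpNorm_sub_le (by simp) hδ.ne'
  have hmain : ∀ᶠ k in atTop, eLpNorm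
      ((φ k).normed μ ⋆[ContinuousLinearMap.lsmul ℝ ℝ, μ] f - f) (ENNReal.ofReal p) μ ≤ δ := by
    -- Once the mollifier has radius below `1`, `ρ ⋆ f - f` vanishes outside this set of finite
    -- measure, so uniform smallness yields smallness in `L^p`.
    set S := cthickening 1 (tsupport f) with hS
    have hScpt : IsCompact S := hfc.isCompact.cthickening
    have hSfin : μ S < ⊤ := hScpt.measure_lt_top
    obtain ⟨r, hr, hrδ⟩ : ∃ r : ℝ, 0 < r ∧
        μ S ^ (ENNReal.ofReal p).toReal⁻¹ * ENNReal.ofReal r ≤ δ := by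
      have hfin : μ S ^ (ENNReal.ofReal p).toReal⁻¹ ≠ ⊤ :=
        ENNReal.rpow_ne_top_of_nonneg (by positivity) hSfin.ne
      have : Tendsto (fun r : ℝ => μ S ^ (ENNReal.ofReal p).toReal⁻¹ * ENNReal.ofReal r)
          (𝓝[>] 0) (𝓝 0) := by
        have h := ENNReal.Tendsto.const_mul (a := μ S ^ (ENNReal.ofReal p).toReal⁻¹)
          ((ENNReal.continuous_ofReal.tendsto 0).mono_left (nhdsWithin_le_nhds (s := Ioi 0)))
          (Or.inr hfin)
        simpa using h
      obtain ⟨r, h1, h2⟩ :=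
        ((this.eventually_le_const hδ).and self_mem_nhdsWithin).exists
      exact ⟨r, h2, h1⟩
    have huc := hfc.uniformContinuous_of_continuous hfcont
    obtain ⟨η, hη, hηr⟩ := Metric.uniformContinuous_iff.1 huc r hr
    filter_upwards [hφ.eventually_lt_const hη, hφ.eventually_lt_const one_pos] with k hk hk1
    have hb : ∀ x, ‖((φ k).normed μ ⋆[ContinuousLinearMap.lsmul ℝ ℝ, μ] f - f) x‖ ≤ r := by
      intro x
      rw [Pi.sub_apply, ← dist_eq_norm]
      refine (φ k).dist_normed_convolution_le hfcont.aestronglyMeasurable fun y hy => ?_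
      exact (hηr (lt_trans (mem_ball.1 hy) hk)).le
    have hsupp : ∀ x, x ∉ S →
        ((φ k).normed μ ⋆[ContinuousLinearMap.lsmul ℝ ℝ, μ] f - f) x = 0 := by
      intro x hx
      rw [Pi.sub_apply, (φ k).normed_convolution_eq_right, sub_self]
      have h0 : ∀ y, dist y x < 1 → f y = 0 := by
        intro y hy
        by_contra hne
        refine hx (mem_cthickening_of_dist_le x y 1 _ (subset_tsupport f hne) ?_)
        rw [dist_comm]; exact hy.le
      intro y hy
      rw [h0 y (lt_trans (mem_ball.1 hy) hk1), h0 x (by simp)]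
    have heq : ((φ k).normed μ ⋆[ContinuousLinearMap.lsmul ℝ ℝ, μ] f - f) =
        S.indicator ((φ k).normed μ ⋆[ContinuousLinearMap.lsmul ℝ ℝ, μ] f - f) := by
      ext x
      by_cases hx : x ∈ S
      · rw [indicator_of_mem hx]
      · rw [indicator_of_notMem hx, hsupp x hx]
    rw [heq, eLpNorm_indicator_eq_eLpNorm_restrict hScpt.measurableSet]
    refine (eLpNorm_le_of_ae_bound (Eventually.of_forall hb)).trans ?_
    simpa using hrδ
  filter_upwards [hmain] with k hk
  have hdecomp : (φ k).normed μ ⋆[ContinuousLinearMap.lsmul ℝ ℝ, μ] g - g =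
      ((φ k).normed μ ⋆[ContinuousLinearMap.lsmul ℝ ℝ, μ] (g - f)) +
      ((φ k).normed μ ⋆[ContinuousLinearMap.lsmul ℝ ℝ, μ] f - f) + (f - g) := by
    have : (φ k).normed μ ⋆[ContinuousLinearMap.lsmul ℝ ℝ, μ] g =
        ((φ k).normed μ ⋆[ContinuousLinearMap.lsmul ℝ ℝ, μ] (g - f)) +
        ((φ k).normed μ ⋆[ContinuousLinearMap.lsmul ℝ ℝ, μ] f) := by
      rw [← ConvolutionExists.distrib_add (hexist k (hg.sub hfmem)) (hexist k hfmem),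
        sub_add_cancel]
    rw [this]; abel
  have hcm : ∀ {h : E → F}, MemLp h (ENNReal.ofReal p) μ → AEStronglyMeasurable
      ((φ k).normed μ ⋆[ContinuousLinearMap.lsmul ℝ ℝ, μ] h) μ := fun hh =>
    ((φ k).hasCompactSupport_normed.continuous_convolution_left _ (φ k).continuous_normed
      (hloc hh)).aestronglyMeasurable
  rw [hdecomp]
  refine (eLpNorm_add_le (((hcm (hg.sub hfmem)).add ((hcm hfmem).sub hfmem.1)))
    (hfmem.1.sub hg.1) hp1).trans ?_
  refine (add_le_add_left (eLpNorm_add_le (hcm (hg.sub hfmem)) ((hcm hfmem).sub hfmem.1) hp1)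
    _).trans ?_
  refine le_trans (add_le_add (add_le_add ?_ hk) ?_) hδε
  · exact (eLpNorm_normed_convolution_le _ hp (hg.sub hfmem).1).trans hfε
  · rwa [← eLpNorm_neg, neg_sub]

end Mollification

/-! ### Weak gradients and smooth approximation -/

section WeakGradient

variable {n : ℕ} {Ω : Set (EuclideanSpace ℝ (Fin n))}

local notation "𝔼" => EuclideanSpace ℝ (Fin n)

theorem inner_gradient_eq_fderiv (f : 𝔼 → ℝ) (x e : 𝔼) :
    inner ℝ (∇ f x) e = fderiv ℝ f x e := by
  simp [gradient, InnerProductSpace.toDual_symm_apply]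

theorem continuous_gradient {f : 𝔼 → ℝ} (hf : ContDiff ℝ ∞ f) : Continuous (∇ f) :=
  (InnerProductSpace.toDual ℝ 𝔼).symm.continuous.comp (hf.continuous_fderiv (by simp))

theorem support_gradient_subset (f : 𝔼 → ℝ) : Function.support (∇ f) ⊆ tsupport f := by
  refine Subset.trans (fun x hx => ?_) (support_fderiv_subset ℝ (f := f))
  intro h
  exact hx (by simp [gradient, h])

theorem gradient_eq_zero_of_notMem_tsupport {f : 𝔼 → ℝ} {x : 𝔼} (hx : x ∉ tsupport f) :
    ∇ f x = 0 := by
  by_contra h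
  exact hx (support_gradient_subset f h)

theorem tsupport_gradient_subset (f : 𝔼 → ℝ) : tsupport (∇ f) ⊆ tsupport f :=
  closure_minimal (support_gradient_subset f) (isClosed_tsupport f)

theorem gradient_mul {f g : 𝔼 → ℝ} {x : 𝔼} (hf : DifferentiableAt ℝ f x)
    (hg : DifferentiableAt ℝ g x) :
    ∇ (fun y => f y * g y) x = f x • ∇ g x + g x • ∇ f x := by
  refine ext_inner_right ℝ fun e => ?_
  rw [inner_gradient_eq_fderiv, fderiv_fun_mul hf hg, inner_add_left, inner_smul_left,
    inner_smul_left, inner_gradient_eq_fderiv, inner_gradient_eq_fderiv]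
  simp

theorem gradient_comp {h : ℝ → ℝ} {f : 𝔼 → ℝ} {x : 𝔼} (hh : DifferentiableAt ℝ h (f x))
    (hf : DifferentiableAt ℝ f x) :
    ∇ (fun y => h (f y)) x = deriv h (f x) • ∇ f x := by
  refine ext_inner_right ℝ fun e => ?_
  rw [inner_gradient_eq_fderiv, fderiv_fun_comp x hh hf, inner_smul_left, inner_gradient_eq_fderiv]
  simp [mul_comm]

theorem integrable_smul_of_locallyIntegrableOn {F : Type*} [NormedAddCommGroup F]
    [NormedSpace ℝ F] {g : 𝔼 → F} (hg : LocallyIntegrableOn g Ω volume) {φ : 𝔼 → ℝ}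
    (hφ : Continuous φ) (hφc : HasCompactSupport φ) (hφΩ : tsupport φ ⊆ Ω) :
    Integrable (fun x => φ x • g x) volume := by
  have h := (hg.integrableOn_compact_subset hφΩ hφc.isCompact).continuousOn_smul
    hφ.continuousOn hφc.isCompact
  refine h.integrable_of_forall_notMem_eq_zero fun x hx => ?_
  simp [image_eq_zero_of_notMem_tsupport hx]

theorem integrable_smul_of_locallyIntegrableOn' {g : 𝔼 → ℝ}
    (hg : LocallyIntegrableOn g Ω volume) {Φ : 𝔼 → 𝔼}
    (hΦ : Continuous Φ) (hΦc : HasCompactSupport Φ) (hΦΩ : tsupport Φ ⊆ Ω) :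
    Integrable (fun x => g x • Φ x) volume := by
  have h := (hg.integrableOn_compact_subset hΦΩ hΦc.isCompact).smul_continuousOn
    hΦ.continuousOn hΦc.isCompact
  refine h.integrable_of_forall_notMem_eq_zero fun x hx => ?_
  simp [image_eq_zero_of_notMem_tsupport hx]

theorem IsTestFunction.gradient_hasCompactSupport {φ : 𝔼 → ℝ} (hφ : IsTestFunction Ω φ) :
    HasCompactSupport (∇ φ) :=
  HasCompactSupport.of_support_subset_isCompact hφ.compact_support.isCompact
    (support_gradient_subset φ)

theorem HasWeakGradient.sub {u v : 𝔼 → ℝ} {G H : 𝔼 → 𝔼} (hu : HasWeakGradient Ω u G)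
    (hv : HasWeakGradient Ω v H) :
    HasWeakGradient Ω (fun x => u x - v x) (fun x => G x - H x) where
  locallyIntegrable := hu.locallyIntegrable.sub hv.locallyIntegrable
  locallyIntegrable_grad := hu.locallyIntegrable_grad.sub hv.locallyIntegrable_grad
  integral_eq φ hφ := by
    have hs := (tsupport_gradient_subset φ).trans hφ.support_subset
    have hc := continuous_gradient hφ.smooth
    simp only [sub_smul, smul_sub]
    rw [integral_sub
        (integrable_smul_of_locallyIntegrableOn' hu.locallyIntegrable hc
          hφ.gradient_hasCompactSupport hs).integrableOn
        (integrable_smul_of_locallyIntegrableOn' hv.locallyIntegrable hc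
          hφ.gradient_hasCompactSupport hs).integrableOn,
      integral_sub
        (integrable_smul_of_locallyIntegrableOn hu.locallyIntegrable_grad
          hφ.smooth.continuous hφ.compact_support hφ.support_subset).integrableOn
        (integrable_smul_of_locallyIntegrableOn hv.locallyIntegrable_grad
          hφ.smooth.continuous hφ.compact_support hφ.support_subset).integrableOn,
      hu.integral_eq φ hφ, hv.integral_eq φ hφ]
    abel

/-- The weak gradient is unique almost everywhere. -/
theorem HasWeakGradient.ae_eq (hΩ : IsOpen Ω) {u : 𝔼 → ℝ} {G H : 𝔼 → 𝔼}
    (hG : HasWeakGradient Ω u G) (hH : HasWeakGradient Ω u H) :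
    G =ᵐ[volume.restrict Ω] H := by
  have key := hΩ.ae_eq_zero_of_integral_contDiff_smul_eq_zero
    (hG.locallyIntegrable_grad.sub hH.locallyIntegrable_grad) (μ := volume) (fun φ h1 h2 h3 => by
      have h := (hG.sub hH).integral_eq φ ⟨h1, h2, h3⟩
      simp only [sub_self, zero_smul, integral_zero] at h
      rw [← setIntegral_eq_integral_of_forall_compl_eq_zero (s := Ω)]
      · simpa using h.symm
      · intro x hx
        simp [image_eq_zero_of_notMem_tsupport (fun h => hx (h3 h))])
  rw [EventuallyEq, ae_restrict_iff' hΩ.measurableSet]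
  filter_upwards [key] with x hx hxΩ
  exact sub_eq_zero.1 (hx hxΩ)

theorem MemLpLoc.congr_ae {F : Type*} [NormedAddCommGroup F] {p : ℝ} {G H : 𝔼 → F}
    (hG : MemLpLoc Ω p G) (h : G =ᵐ[volume.restrict Ω] H) : MemLpLoc Ω p H :=
  fun C hC hCΩ => (hG C hC hCΩ).ae_eq (ae_restrict_of_ae_restrict_of_subset hCΩ h)

/-- The mollification of a weakly differentiable function, restricted to a neighbourhood of `x`
containing the support of the mollifier, has the mollified weak gradient as gradient. -/
theorem gradient_normed_convolution (φ : ContDiffBump (0 : 𝔼)) {S : Set 𝔼} (hS : IsCompact S)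
    (hSΩ : S ⊆ Ω) {w : 𝔼 → ℝ} {G : 𝔼 → 𝔼} (hG : HasWeakGradient Ω w G) {x : 𝔼}
    (hx : closedBall x φ.rOut ⊆ S) :
    ∇ (φ.normed volume ⋆[ContinuousLinearMap.lsmul ℝ ℝ, volume] S.indicator w) x =
      (φ.normed volume ⋆[ContinuousLinearMap.lsmul ℝ ℝ, volume] S.indicator G) x := by
  set ρ := φ.normed (volume : Measure 𝔼) with hρ
  have hρs : ContDiff ℝ ∞ ρ := φ.contDiff_normed
  have hρc : HasCompactSupport ρ := φ.hasCompactSupport_normed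
  have hwi : Integrable (S.indicator w) volume :=
    (hG.locallyIntegrable.integrableOn_compact_subset hSΩ hS).integrable_indicator
      hS.measurableSet
  -- The translated reflected mollifier is an admissible test function supported in `S`. Inserting
  -- it in the weak gradient identity moves the derivative from `ρ` to `w`; the sign from the
  -- reflection cancels the sign of the identity.
  set ψ : 𝔼 → ℝ := fun t => ρ (x - t) with hψ
  have hψsupp : tsupport ψ ⊆ closedBall x φ.rOut := by
    refine closure_minimal (fun t ht => ?_) isClosed_closedBall
    have : x - t ∈ Function.support ρ := ht
    rw [hρ, φ.support_normed_eq, mem_ball_zero_iff] at this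
    rw [mem_closedBall, dist_comm, dist_eq_norm]
    exact this.le
  have hψt : IsTestFunction Ω ψ :=
    ⟨hρs.comp (contDiff_const.sub contDiff_id),
      HasCompactSupport.of_support_subset_isCompact (isCompact_closedBall x φ.rOut)
        ((subset_tsupport ψ).trans hψsupp), (hψsupp.trans hx).trans hSΩ⟩
  have hgradψ : ∀ t, ∇ ψ t = - ∇ ρ (x - t) := by
    intro t
    refine ext_inner_right ℝ fun e => ?_
    rw [inner_gradient_eq_fderiv, inner_neg_left, inner_gradient_eq_fderiv]
    have hd : HasFDerivAt ψ ((fderiv ℝ ρ (x - t)).comp (-ContinuousLinearMap.id ℝ 𝔼)) t :=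
      ((hρs.differentiable (by simp) (x - t)).hasFDerivAt).comp t
        ((hasFDerivAt_id t).const_sub x)
    rw [hd.fderiv]
    simp
  have hweak := hG.integral_eq ψ hψt
  have hΩS : ∀ {F : Type} [NormedAddCommGroup F] [NormedSpace ℝ F] (f : 𝔼 → F),
      (∀ t, t ∉ S → f t = 0) → ∫ t in Ω, f t = ∫ t, f t := fun f hf =>
    setIntegral_eq_integral_of_forall_compl_eq_zero fun t ht => hf t fun h => ht (hSΩ h)
  have hnot : ∀ {t}, t ∉ S → t ∉ tsupport ψ := fun ht h => ht (hx (hψsupp h))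
  have hR : (ρ ⋆[ContinuousLinearMap.lsmul ℝ ℝ, volume] S.indicator G) x =
      ∫ t in Ω, ψ t • G t := by
    rw [convolution_lsmul_swap, hΩS]
    · refine integral_congr_ae (Eventually.of_forall fun t => ?_)
      by_cases ht : t ∈ S
      · simp [indicator_of_mem ht, hψ]
      · have := image_eq_zero_of_notMem_tsupport (hnot ht)
        simp only [hψ] at this
        simp [hψ, this]
    · intro t ht
      simp [image_eq_zero_of_notMem_tsupport (hnot ht)]
  have hL : ∫ t in Ω, w t • ∇ ψ t = - ∫ t, S.indicator w t • ∇ ρ (x - t) := by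
    rw [hΩS, ← integral_neg]
    · refine integral_congr_ae (Eventually.of_forall fun t => ?_)
      by_cases ht : t ∈ S
      · simp [indicator_of_mem ht, hgradψ]
      · simp [indicator_of_notMem ht, gradient_eq_zero_of_notMem_tsupport (hnot ht)]
    · intro t ht
      simp [gradient_eq_zero_of_notMem_tsupport (hnot ht)]
  rw [hL, neg_inj, ← hR] at hweak
  rw [← hweak]
  have hder := hρc.hasFDerivAt_convolution_left (ContinuousLinearMap.lsmul ℝ ℝ)
    (hρs.of_le (by simp)) hwi.locallyIntegrable x
  have hint : Integrable (fun t => S.indicator w t • ∇ ρ (x - t)) volume := by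
    have hcont : Continuous fun t => ∇ ρ (x - t) :=
      (continuous_gradient hρs).comp (continuous_const.sub continuous_id)
    have hcs : HasCompactSupport fun t => ∇ ρ (x - t) := by
      have := hψt.gradient_hasCompactSupport.neg
      convert this using 1
      ext1 t
      simp [hgradψ]
    exact hwi.locallyIntegrable.integrable_smul_right_of_hasCompactSupport hcont hcs
  refine ext_inner_left ℝ fun e => ?_
  rw [real_inner_comm, inner_gradient_eq_fderiv, hder.fderiv, ← integral_inner hint e,
    convolution_eq_swap, ContinuousLinearMap.integral_apply]
  · refine integral_congr_ae (Eventually.of_forall fun t => ?_)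
    simp only [ContinuousLinearMap.precompL_apply, ContinuousLinearMap.lsmul_apply,
      inner_smul_right]
    rw [real_inner_comm, inner_gradient_eq_fderiv, smul_eq_mul, mul_comm]
  · exact ((hρc.fderiv ℝ).convolutionExists_left _ (hρs.continuous_fderiv (by simp))
      hwi.locallyIntegrable x).integrable_swap

/-- Local approximation of a continuous Sobolev function by smooth functions. -/
theorem HasWeakGradient.exists_smooth_approx (hΩ : IsOpen Ω) {p : ℝ} (hp : 1 ≤ p) {w : 𝔼 → ℝ}
    {G : 𝔼 → 𝔼} (hw : ContinuousOn w Ω) (hG : HasWeakGradient Ω w G) (hGp : MemLpLoc Ω p G)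
    {C : Set 𝔼} (hC : IsCompact C) (hCΩ : C ⊆ Ω) :
    ∃ W : ℕ → 𝔼 → ℝ, (∀ k, ContDiff ℝ ∞ (W k)) ∧ TendstoUniformlyOn W w atTop C ∧
      Tendsto (fun k => eLpNorm (fun x => ∇ (W k) x - G x) (ENNReal.ofReal p)
        (volume.restrict C)) atTop (𝓝 0) := by
  obtain ⟨δ, hδ, hδΩ⟩ := hC.exists_cthickening_subset_open hΩ hCΩ
  -- Restricting `w` and `G` to a compact thickening makes them globally integrable. Mollifiers of
  -- radius at most `δ` see only `S` from points of `C`, so the truncation does no harm there.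
  set S := cthickening δ C with hSdef
  have hS : IsCompact S := hC.cthickening
  have hball : ∀ x ∈ C, closedBall x δ ⊆ S := fun x hx =>
    closedBall_subset_cthickening hx δ
  have hCS : C ⊆ S := self_subset_cthickening C
  let φ : ℕ → ContDiffBump (0 : 𝔼) := fun k =>
    ⟨δ / (k + 1) / 2, δ / (k + 1), by positivity, half_lt_self (by positivity)⟩
  have hφr : ∀ k, (φ k).rOut = δ / (k + 1) := fun k => rfl
  have hφle : ∀ k, (φ k).rOut ≤ δ := fun k => by
    rw [hφr]; exact div_le_self hδ.le (by linarith [(Nat.cast_nonneg k : (0 : ℝ) ≤ k)])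
  have hφ0 : Tendsto (fun k => (φ k).rOut) atTop (𝓝 0) := by
    simp only [hφr]
    exact (tendsto_const_div_atTop_nhds_zero_nat δ).comp (tendsto_add_atTop_nat 1) |>.congr
      fun k => by simp
  have hwi : Integrable (S.indicator w) volume :=
    (hG.locallyIntegrable.integrableOn_compact_subset hδΩ hS).integrable_indicator
      hS.measurableSet
  have hGS : MemLp (S.indicator G) (ENNReal.ofReal p) volume :=
    (memLp_indicator_iff_restrict hS.measurableSet).2 (hGp S hS hδΩ)
  refine ⟨fun k => (φ k).normed volume ⋆[ContinuousLinearMap.lsmul ℝ ℝ, volume] S.indicator w,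
    fun k => ?_, ?_, ?_⟩
  · exact (φ k).hasCompactSupport_normed.contDiff_convolution_left _ (φ k).contDiff_normed
      hwi.locallyIntegrable
  · rw [Metric.tendstoUniformlyOn_iff]
    intro ε hε
    have huc : UniformContinuousOn w S :=
      hS.uniformContinuousOn_of_continuous (hw.mono hδΩ)
    obtain ⟨η, hη, hηε⟩ := Metric.uniformContinuousOn_iff.1 huc (ε / 2) (half_pos hε)
    filter_upwards [hφ0.eventually_lt_const hη] with k hk x hx
    rw [dist_comm, ← indicator_of_mem (hCS hx) w]
    refine lt_of_le_of_lt ((φ k).dist_normed_convolution_le hwi.aestronglyMeasurable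
      (ε := ε / 2) fun y hy => ?_) (half_lt_self hε)
    have hyS : y ∈ S := hball x hx (ball_subset_closedBall (ball_subset_ball (hφle k) hy))
    rw [indicator_of_mem hyS, indicator_of_mem (hCS hx)]
    exact (hηε y hyS x (hCS hx) (lt_trans (mem_ball.1 hy) hk)).le
  · refine tendsto_of_tendsto_of_tendsto_of_le_of_le tendsto_const_nhds
      (tendsto_eLpNorm_normed_convolution_sub hφ0 hp hGS) (fun k => bot_le) fun k => ?_
    refine le_trans (le_of_eq (eLpNorm_congr_ae ?_))
      (eLpNorm_mono_measure _ Measure.restrict_le_self)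
    refine (ae_restrict_iff' hC.measurableSet).2 (Eventually.of_forall fun x hx => ?_)
    simp only
    rw [Pi.sub_apply, indicator_of_mem (hCS hx),
      gradient_normed_convolution (φ k) hS hδΩ hG
        ((closedBall_subset_closedBall (hφle k)).trans (hball x hx))]

end WeakGradient

/-! ### Testing the equation with nonsmooth functions -/

section Testing

variable {n : ℕ} {Ω : Set (EuclideanSpace ℝ (Fin n))}

local notation "𝔼" => EuclideanSpace ℝ (Fin n)

/-- Hölder's inequality for the inner product of two vector fields. -/
theorem eLpNorm_inner_le {α : Type*} [MeasurableSpace α] {μ : Measure α} {p q : ℝ}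
    (hpq : p.HolderConjugate q) {B D : α → 𝔼} (hB : AEStronglyMeasurable B μ)
    (hD : AEStronglyMeasurable D μ) :
    eLpNorm (fun x => inner ℝ (B x) (D x)) 1 μ ≤
      eLpNorm B (ENNReal.ofReal q) μ * eLpNorm D (ENNReal.ofReal p) μ := by
  have : (ENNReal.ofReal q).HolderConjugate (ENNReal.ofReal p) := hpq.symm.ennrealOfReal
  have h := eLpNorm_le_eLpNorm_mul_eLpNorm'_of_norm (p := ENNReal.ofReal q)
    (q := ENNReal.ofReal p) (r := 1) hB hD (fun a b => inner ℝ a b) 1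
    (Eventually.of_forall fun x => by simpa using norm_inner_le_norm (𝕜 := ℝ) (B x) (D x))
  simpa using h

theorem integrable_inner_of_memLp {α : Type*} [MeasurableSpace α] {μ : Measure α} {p q : ℝ}
    (hpq : p.HolderConjugate q) {B D : α → 𝔼} (hB : MemLp B (ENNReal.ofReal q) μ)
    (hD : MemLp D (ENNReal.ofReal p) μ) : Integrable (fun x => inner ℝ (B x) (D x)) μ := by
  rw [← memLp_one_iff_integrable]
  exact ⟨hB.1.inner hD.1, (eLpNorm_inner_le hpq hB.1 hD.1).trans_lt
    (ENNReal.mul_lt_top hB.2 hD.2)⟩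

theorem tendsto_setIntegral_mul_of_bounded {C : Set 𝔼} (hC : MeasurableSet C) {c : ℕ → 𝔼 → ℝ}
    {c' g : 𝔼 → ℝ} {M : ℝ} (hcc : ∀ k, Continuous (c k))
    (hlim : ∀ x ∈ C, Tendsto (fun k => c k x) atTop (𝓝 (c' x)))
    (hbd : ∀ᶠ k in atTop, ∀ x ∈ C, |c k x| ≤ M) (hg : IntegrableOn g C volume) :
    Tendsto (fun k => ∫ x in C, c k x * g x) atTop (𝓝 (∫ x in C, c' x * g x)) := by
  refine tendsto_integral_filter_of_dominated_convergence (fun x => M * |g x|) ?_ ?_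
    (hg.abs.const_mul M) ?_
  · exact Eventually.of_forall fun k => (hcc k).aestronglyMeasurable.mul hg.1
  · filter_upwards [hbd] with k hk
    refine (ae_restrict_iff' hC).2 (Eventually.of_forall fun x hx => ?_)
    rw [Real.norm_eq_abs, abs_mul]
    exact mul_le_mul_of_nonneg_right (hk x hx) (abs_nonneg _)
  · exact (ae_restrict_iff' hC).2 (Eventually.of_forall fun x hx =>
      (hlim x hx).mul tendsto_const_nhds)

/-- Testing a divergence-form equation `-div B = f` with `h(w) Ψ`, where `w` is a continuous
Sobolev function. -/
theorem testing_with_comp_mul (hΩ : IsOpen Ω) {p q : ℝ} (hpq : p.HolderConjugate q)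
    {B : 𝔼 → 𝔼} (hB : MemLpLoc Ω q B) {f : 𝔼 → ℝ} (hf : LocallyIntegrableOn f Ω volume)
    (hBf : ∀ φ, IsTestFunction Ω φ →
      ∫ x in Ω, inner ℝ (B x) (∇ φ x) = ∫ x in Ω, f x * φ x)
    {w : 𝔼 → ℝ} {G : 𝔼 → 𝔼} (hw : ContinuousOn w Ω) (hG : HasWeakGradient Ω w G)
    (hGp : MemLpLoc Ω p G) {h : ℝ → ℝ} (hh : ContDiff ℝ ∞ h) {Ψ : 𝔼 → ℝ}
    (hΨ : IsTestFunction Ω Ψ) :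
    IntegrableOn (fun x => Ψ x * deriv h (w x) * inner ℝ (B x) (G x)) Ω volume ∧
    IntegrableOn (fun x => h (w x) * inner ℝ (B x) (∇ Ψ x)) Ω volume ∧
    IntegrableOn (fun x => h (w x) * Ψ x * f x) Ω volume ∧
    (∫ x in Ω, Ψ x * deriv h (w x) * inner ℝ (B x) (G x)) +
      ∫ x in Ω, h (w x) * inner ℝ (B x) (∇ Ψ x) = ∫ x in Ω, h (w x) * Ψ x * f x := by
  set C := tsupport Ψ with hCdef
  have hC : IsCompact C := hΨ.compact_support.isCompact
  have hCΩ : C ⊆ Ω := hΨ.support_subset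
  have hCm : MeasurableSet C := hC.measurableSet
  have hhc : Continuous h := hh.continuous
  have hh'c : Continuous (deriv h) := hh.continuous_deriv (by simp)
  have hΨc : Continuous Ψ := hΨ.smooth.continuous
  have hgΨc : Continuous (∇ Ψ) := continuous_gradient hΨ.smooth
  have hwC : ContinuousOn w C := hw.mono hCΩ
  have hBC : MemLp B (ENNReal.ofReal q) (volume.restrict C) := hB C hC hCΩ
  have hGC : MemLp G (ENNReal.ofReal p) (volume.restrict C) := hGp C hC hCΩ
  have hcontp : ∀ {F : 𝔼 → 𝔼}, Continuous F → MemLp F (ENNReal.ofReal p) (volume.restrict C) := by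
    intro F hF
    have : IsFiniteMeasure ((volume : Measure 𝔼).restrict C) :=
      ⟨by simpa using hC.measure_lt_top⟩
    obtain ⟨M, hM⟩ := hC.exists_bound_of_continuousOn hF.continuousOn
    exact MemLp.of_bound hF.aestronglyMeasurable M
      ((ae_restrict_iff' hCm).2 (Eventually.of_forall hM))
  have hBG : IntegrableOn (fun x => inner ℝ (B x) (G x)) C volume :=
    integrable_inner_of_memLp hpq hBC hGC
  have hBΨ : IntegrableOn (fun x => inner ℝ (B x) (∇ Ψ x)) C volume :=
    integrable_inner_of_memLp hpq hBC (hcontp hgΨc)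
  have hfC : IntegrableOn f C volume := hf.integrableOn_compact_subset hCΩ hC
  have hΨ0 : ∀ {x}, x ∉ C → Ψ x = 0 := fun hx => image_eq_zero_of_notMem_tsupport hx
  have hgΨ0 : ∀ {x}, x ∉ C → ∇ Ψ x = 0 := fun hx => gradient_eq_zero_of_notMem_tsupport hx
  have hsub : ∀ g : 𝔼 → ℝ, (∀ x, x ∉ C → g x = 0) → ∫ x in Ω, g x = ∫ x in C, g x :=
    fun g hg => by
      rw [setIntegral_eq_integral_of_forall_compl_eq_zero fun x hx => hg x fun h => hx (hCΩ h),
        setIntegral_eq_integral_of_forall_compl_eq_zero hg]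
  have hext : ∀ {g : 𝔼 → ℝ}, IntegrableOn g C volume → (∀ x, x ∉ C → g x = 0) →
      IntegrableOn g Ω volume := fun hg h0 =>
    (hg.integrable_of_forall_notMem_eq_zero h0).integrableOn
  have h10 : ∀ x, x ∉ C → Ψ x * deriv h (w x) * inner ℝ (B x) (G x) = 0 := fun x hx => by
    simp [hΨ0 hx]
  have h20 : ∀ x, x ∉ C → h (w x) * inner ℝ (B x) (∇ Ψ x) = 0 := fun x hx => by
    simp [hgΨ0 hx]
  have h30 : ∀ x, x ∉ C → h (w x) * Ψ x * f x = 0 := fun x hx => by simp [hΨ0 hx]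
  have hI1 : IntegrableOn (fun x => Ψ x * deriv h (w x) * inner ℝ (B x) (G x)) C volume :=
    hBG.continuousOn_mul (hΨc.continuousOn.mul (hh'c.comp_continuousOn hwC)) hC
  have hI2 : IntegrableOn (fun x => h (w x) * inner ℝ (B x) (∇ Ψ x)) C volume :=
    hBΨ.continuousOn_mul (hhc.comp_continuousOn hwC) hC
  have hI3 : IntegrableOn (fun x => h (w x) * Ψ x * f x) C volume :=
    hfC.continuousOn_mul ((hhc.comp_continuousOn hwC).mul hΨc.continuousOn) hC
  refine ⟨hext hI1 h10, hext hI2 h20, hext hI3 h30, ?_⟩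
  rw [hsub _ h10, hsub _ h20, hsub _ h30]
  -- For smooth `W k` the product `h (W k) * Ψ` is a genuine test function; the identity for `w` is
  -- the limit of these.
  obtain ⟨W, hWs, hWu, hWg⟩ := hG.exists_smooth_approx hΩ hpq.lt.le hw hGp hC hCΩ
  obtain ⟨Mw, hMw⟩ := hC.exists_bound_of_continuousOn hwC
  obtain ⟨MΨ, hMΨ⟩ := hC.exists_bound_of_continuousOn hΨc.continuousOn
  -- Uniform convergence puts `W k` within `1` of `w` on `C` eventually, so `h` and `deriv h` need
  -- bounds only on this interval.
  obtain ⟨M1, hM1⟩ := (isCompact_Icc (a := -(Mw + 1)) (b := Mw + 1)).exists_bound_of_continuousOn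
    hhc.continuousOn
  obtain ⟨M2, hM2⟩ := (isCompact_Icc (a := -(Mw + 1)) (b := Mw + 1)).exists_bound_of_continuousOn
    hh'c.continuousOn
  have hWb : ∀ᶠ k in atTop, ∀ x ∈ C, W k x ∈ Icc (-(Mw + 1)) (Mw + 1) := by
    filter_upwards [Metric.tendstoUniformlyOn_iff.1 hWu 1 one_pos] with k hk x hx
    have h1 := hk x hx
    have h2 := hMw x hx
    rw [Real.dist_eq, abs_lt] at h1
    rw [Real.norm_eq_abs, abs_le] at h2
    constructor <;> linarith [h1.1, h1.2, h2.1, h2.2]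
  have hWpt : ∀ x ∈ C, Tendsto (fun k => W k x) atTop (𝓝 (w x)) := fun x hx =>
    hWu.tendsto_at hx
  have hgW : ∀ k, Continuous (∇ (W k)) := fun k => continuous_gradient (hWs k)
  have hΨb : ∀ {k x}, x ∈ C → |deriv h (W k x)| ≤ M2 → |Ψ x * deriv h (W k x)| ≤ MΨ * M2 := by
    intro k x hx hk
    rw [abs_mul]
    exact mul_le_mul (hMΨ x hx) hk (abs_nonneg _) ((norm_nonneg _).trans (hMΨ x hx))
  have hT1 : Tendsto (fun k => ∫ x in C, Ψ x * deriv h (W k x) * inner ℝ (B x) (G x)) atTop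
      (𝓝 (∫ x in C, Ψ x * deriv h (w x) * inner ℝ (B x) (G x))) := by
    refine tendsto_setIntegral_mul_of_bounded (M := MΨ * M2) hCm
      (fun k => hΨc.mul (hh'c.comp (hWs k).continuous)) (fun x hx => ?_) ?_ hBG
    · exact tendsto_const_nhds.mul ((hh'c.tendsto _).comp (hWpt x hx))
    · filter_upwards [hWb] with k hk x hx using hΨb hx (hM2 _ (hk x hx))
  have hT2 : Tendsto (fun k => ∫ x in C, h (W k x) * inner ℝ (B x) (∇ Ψ x)) atTop
      (𝓝 (∫ x in C, h (w x) * inner ℝ (B x) (∇ Ψ x))) := by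
    refine tendsto_setIntegral_mul_of_bounded (M := M1) hCm
      (fun k => hhc.comp (hWs k).continuous) (fun x hx => ?_) ?_ hBΨ
    · exact (hhc.tendsto _).comp (hWpt x hx)
    · filter_upwards [hWb] with k hk x hx using hM1 _ (hk x hx)
  have hT3 : Tendsto (fun k => ∫ x in C, h (W k x) * Ψ x * f x) atTop
      (𝓝 (∫ x in C, h (w x) * Ψ x * f x)) := by
    refine tendsto_setIntegral_mul_of_bounded (M := M1 * MΨ) hCm
      (fun k => (hhc.comp (hWs k).continuous).mul hΨc) (fun x hx => ?_) ?_ hfC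
    · exact ((hhc.tendsto _).comp (hWpt x hx)).mul tendsto_const_nhds
    · filter_upwards [hWb] with k hk x hx
      rw [abs_mul]
      have := hM1 _ (hk x hx)
      exact mul_le_mul this (hMΨ x hx) (abs_nonneg _) ((norm_nonneg _).trans this)
  have hBW : ∀ k, IntegrableOn (fun x => inner ℝ (B x) (∇ (W k) x - G x)) C volume := fun k =>
    integrable_inner_of_memLp hpq hBC ((hcontp (hgW k)).sub hGC)
  have hI4 : ∀ k, IntegrableOn
      (fun x => Ψ x * deriv h (W k x) * inner ℝ (B x) (∇ (W k) x - G x)) C volume := fun k =>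
    (hBW k).continuousOn_mul (hΨc.mul (hh'c.comp (hWs k).continuous)).continuousOn hC
  -- The error of replacing `∇ (W k)` by `G`: bounded coefficients, `B` in `L^q` and gradients
  -- converging in `L^p`, combined by Hölder.
  have hT4 : Tendsto (fun k => ∫ x in C,
      Ψ x * deriv h (W k x) * inner ℝ (B x) (∇ (W k) x - G x)) atTop (𝓝 0) := by
    rw [← integral_zero 𝔼 ℝ (μ := volume.restrict C)]
    refine tendsto_integral_of_L1' _ aestronglyMeasurable_const
      (Eventually.of_forall hI4) ?_
    have hlim : Tendsto (fun k => ENNReal.ofReal (MΨ * M2) *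
        (eLpNorm B (ENNReal.ofReal q) (volume.restrict C) *
          eLpNorm (fun x => ∇ (W k) x - G x) (ENNReal.ofReal p) (volume.restrict C)))
        atTop (𝓝 0) := by
      have h1 := ENNReal.Tendsto.const_mul
        (a := eLpNorm B (ENNReal.ofReal q) (volume.restrict C)) hWg (Or.inr hBC.2.ne)
      have h2 := ENNReal.Tendsto.const_mul (a := ENNReal.ofReal (MΨ * M2)) h1
        (Or.inr ENNReal.ofReal_ne_top)
      simpa using h2
    refine tendsto_of_tendsto_of_tendsto_of_le_of_le' tendsto_const_nhds hlim
      (Eventually.of_forall fun k => bot_le) ?_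
    filter_upwards [hWb] with k hk
    refine le_trans ?_ (mul_le_mul_right (eLpNorm_inner_le hpq hBC.1
      ((hgW k).aestronglyMeasurable.sub hGC.1)) _)
    refine eLpNorm_le_mul_eLpNorm_of_ae_le_mul ?_ 1
    refine (ae_restrict_iff' hCm).2 (Eventually.of_forall fun x hx => ?_)
    simp only [Pi.sub_apply, sub_zero]
    rw [norm_mul]
    exact mul_le_mul_of_nonneg_right (hΨb hx (hM2 _ (hk x hx))) (norm_nonneg _)
  have hid : ∀ k, (∫ x in C, Ψ x * deriv h (W k x) * inner ℝ (B x) (G x)) +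
      (∫ x in C, h (W k x) * inner ℝ (B x) (∇ Ψ x)) +
      ∫ x in C, Ψ x * deriv h (W k x) * inner ℝ (B x) (∇ (W k) x - G x) =
      ∫ x in C, h (W k x) * Ψ x * f x := by
    intro k
    have hcomp : ContDiff ℝ ∞ (fun x => h (W k x)) := hh.comp (hWs k)
    have htest : IsTestFunction Ω (fun x => h (W k x) * Ψ x) :=
      ⟨hcomp.mul hΨ.smooth, hΨ.compact_support.mul_left,
        (closure_mono (Function.support_mul_subset_right _ _)).trans hΨ.support_subset⟩
    have hgrad : ∀ x, ∇ (fun x => h (W k x) * Ψ x) x =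
        h (W k x) • ∇ Ψ x + Ψ x • deriv h (W k x) • ∇ (W k) x := by
      intro x
      rw [gradient_mul (hcomp.differentiable (by simp) x)
        (hΨ.smooth.differentiable (by simp) x),
        gradient_comp (hh.differentiable (by simp) _) ((hWs k).differentiable (by simp) x)]
    have hJ1 : IntegrableOn (fun x => Ψ x * deriv h (W k x) * inner ℝ (B x) (G x)) C volume :=
      hBG.continuousOn_mul (hΨc.mul (hh'c.comp (hWs k).continuous)).continuousOn hC
    have hJ2 : IntegrableOn (fun x => h (W k x) * inner ℝ (B x) (∇ Ψ x)) C volume :=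
      hBΨ.continuousOn_mul hcomp.continuous.continuousOn hC
    have heq := hBf _ htest
    rw [hsub _ (fun x hx => by rw [hgrad, hΨ0 hx, hgΨ0 hx]; simp),
      hsub _ (fun x hx => by rw [hΨ0 hx]; simp)] at heq
    rw [← integral_add' hJ1 hJ2, ← integral_add' (hJ1.add hJ2) (hI4 k)]
    refine Eq.trans ?_ (heq.trans ?_)
    · refine integral_congr_ae (Eventually.of_forall fun x => ?_)
      simp only [hgrad, Pi.add_apply, inner_add_right, inner_smul_right, inner_sub_right]
      ring
    · refine integral_congr_ae (Eventually.of_forall fun x => ?_)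
      simp only
      ring
  have := tendsto_nhds_unique (((hT1.add hT2).add hT4).congr hid) hT3
  simpa using this

/-- The divergence theorem for compactly supported functions. -/
theorem IsTestFunction.integral_inner_gradient {φ : 𝔼 → ℝ} (hφ : IsTestFunction Ω φ) (e : 𝔼) :
    ∫ x in Ω, inner ℝ e (∇ φ x) = 0 := by
  rw [setIntegral_eq_integral_of_forall_compl_eq_zero fun x hx => by
    rw [gradient_eq_zero_of_notMem_tsupport fun h => hx (hφ.support_subset h), inner_zero_right]]
  have hc : Continuous fun x => fderiv ℝ φ x e :=
    (hφ.smooth.continuous_fderiv (by simp)).clm_apply continuous_const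
  have hcs : HasCompactSupport fun x => fderiv ℝ φ x e := hφ.compact_support.fderiv_apply ℝ e
  have h := integral_mul_fderiv_eq_neg_fderiv_mul_of_integrable (μ := (volume : Measure 𝔼))
    (f := fun _ => (1 : ℝ)) (g := φ) (v := e) (by simp)
    (by simpa using hc.integrable_of_hasCompactSupport hcs)
    (by simpa using hφ.smooth.continuous.integrable_of_hasCompactSupport hφ.compact_support)
    (by simp) (fun x _ => hφ.smooth.differentiable (by simp) x)
  simp only [one_mul, fderiv_fun_const, Pi.zero_apply, _root_.zero_apply, zero_mul,
    integral_zero, neg_zero] at h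
  rw [← h]
  refine integral_congr_ae (Eventually.of_forall fun x => ?_)
  simp only
  rw [real_inner_comm, inner_gradient_eq_fderiv]

/-- If the chain-rule gradient of `h(w)` vanishes almost everywhere, then `h(w)` has zero
distributional gradient. -/
theorem setIntegral_comp_smul_gradient_eq_zero (hΩ : IsOpen Ω) {p : ℝ} (hp : 1 < p)
    {w : 𝔼 → ℝ} {G : 𝔼 → 𝔼} (hw : ContinuousOn w Ω) (hG : HasWeakGradient Ω w G)
    (hGp : MemLpLoc Ω p G) {h : ℝ → ℝ} (hh : ContDiff ℝ ∞ h)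
    (hzero : ∀ᵐ x ∂volume.restrict Ω, deriv h (w x) • G x = 0) {Ψ : 𝔼 → ℝ}
    (hΨ : IsTestFunction Ω Ψ) (e : 𝔼) :
    ∫ x in Ω, h (w x) * inner ℝ e (∇ Ψ x) = 0 := by
  have hpq : p.HolderConjugate p.conjExponent := Real.HolderConjugate.conjExponent hp
  have hB : MemLpLoc Ω p.conjExponent (fun _ : 𝔼 => e) := fun C hC _ => by
    have : IsFiniteMeasure ((volume : Measure 𝔼).restrict C) :=
      ⟨by simpa using hC.measure_lt_top⟩
    exact memLp_const e
  -- The constant field `e` is divergence free, so the testing lemma applies with `f = 0`, and the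
  -- term containing `deriv h` drops out by `hzero`.
  obtain ⟨-, -, -, h4⟩ := testing_with_comp_mul hΩ hpq hB (f := fun _ => 0)
    ((locallyIntegrable_zero).locallyIntegrableOn Ω)
    (fun φ hφ => by simpa using hφ.integral_inner_gradient e) hw hG hGp hh hΨ
  rw [integral_eq_zero_of_ae (μ := volume.restrict Ω)
    (f := fun x => Ψ x * deriv h (w x) * inner ℝ e (G x))] at h4
  · simpa using h4
  · filter_upwards [hzero] with x hx
    have : deriv h (w x) * inner ℝ e (G x) = 0 := by
      rw [← inner_smul_right, hx, inner_zero_right]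
    simp [mul_assoc, this]

/-- A continuous function on the whole space with zero distributional gradient is constant. -/
theorem eq_of_distributional_gradient_eq_zero {H : 𝔼 → ℝ} (hH : Continuous H)
    (hzero : ∀ φ, IsTestFunction univ φ → ∀ e, ∫ x, H x * inner ℝ e (∇ φ x) = 0) (x y : 𝔼) :
    H x = H y := by
  have hweak : HasWeakGradient univ H 0 := by
    refine ⟨hH.locallyIntegrable.locallyIntegrableOn _,
      locallyIntegrable_zero.locallyIntegrableOn _, fun φ hφ => ?_⟩
    simp only [Measure.restrict_univ, Pi.zero_apply, smul_zero, integral_zero, neg_zero]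
    have hint := integrable_smul_of_locallyIntegrableOn'
      (hH.locallyIntegrable.locallyIntegrableOn univ) (continuous_gradient hφ.smooth)
      hφ.gradient_hasCompactSupport (subset_univ _)
    refine ext_inner_left ℝ fun e => ?_
    rw [← integral_inner hint e, inner_zero_right, ← hzero φ hφ e]
    simp only [inner_smul_right]
  -- Mollifications of `H` are smooth with vanishing derivative, hence constant, and they converge
  -- pointwise to `H`.
  set S : ℕ → ContDiffBump (0 : 𝔼) := fun k =>
    ⟨1 / ((k : ℝ) + 1) / 2, 1 / ((k : ℝ) + 1), by positivity, half_lt_self (by positivity)⟩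
  have hS0 : Tendsto (fun k => (S k).rOut) atTop (𝓝 0) :=
    tendsto_one_div_add_atTop_nhds_zero_nat
  have hlim := fun z => ContDiffBump.convolution_tendsto_right_of_continuous
    (μ := (volume : Measure 𝔼)) hS0 hH z
  refine tendsto_nhds_unique (hlim x) ((hlim y).congr fun k => ?_)
  refine is_const_of_fderiv_eq_zero (𝕜 := ℝ) ?_ (fun z => ?_) y x
  · exact ((S k).hasCompactSupport_normed.contDiff_convolution_left _
      ((S k).contDiff_normed (n := 1)) hH.locallyIntegrable).differentiable (by simp)
  · have hr := (S k).rOut_pos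
    set D := closedBall z (2 * (S k).rOut) with hD
    -- A point within `rOut` of `z`, shifted by less than `rOut`, stays in the ball of radius `2 *
    -- rOut`. So near `z` the convolution involves only a compact piece of `H`.
    have hev : (S k).normed volume ⋆[ContinuousLinearMap.lsmul ℝ ℝ, volume] H =ᶠ[𝓝 z]
        (S k).normed volume ⋆[ContinuousLinearMap.lsmul ℝ ℝ, volume] D.indicator H := by
      filter_upwards [ball_mem_nhds z hr] with y hy
      simp only [convolution_def]
      refine integral_congr_ae (Eventually.of_forall fun t => ?_)
      by_cases ht : t ∈ Function.support ((S k).normed (volume : Measure 𝔼))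
      · have hyt : y - t ∈ D := by
          rw [(S k).support_normed_eq, mem_ball_zero_iff] at ht
          rw [mem_ball, dist_eq_norm] at hy
          rw [hD, mem_closedBall, dist_eq_norm, sub_right_comm]
          linarith [norm_sub_le (y - z) t]
        simp only [indicator_of_mem hyt]
      · simp [Function.notMem_support.1 ht]
    have hg := gradient_normed_convolution (S k) (isCompact_closedBall z (2 * (S k).rOut))
      (subset_univ D) hweak (closedBall_subset_closedBall (by linarith))
    rw [hev.fderiv_eq]
    ext e
    rw [← inner_gradient_eq_fderiv, hg]
    simp

end Testing

/-! ### Growth, coercivity and monotonicity of the vector field -/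

section Structure

variable {n : ℕ} {K : Set (EuclideanSpace ℝ (Fin n))} {p : ℝ}
  {A : EuclideanSpace ℝ (Fin n) → EuclideanSpace ℝ (Fin n) → EuclideanSpace ℝ (Fin n)}

local notation "𝔼" => EuclideanSpace ℝ (Fin n)

theorem StructureConditions.differentiableAt (hA : StructureConditions K p A) {x η : 𝔼}
    (hx : x ∈ Kᶜ) (hη : η ≠ 0) : DifferentiableAt ℝ (A x) η := by
  obtain ⟨D, -, hD⟩ := hA.contDiff
  have h : HasFDerivAt (fun ζ : 𝔼 => (x, ζ)) (ContinuousLinearMap.inr ℝ 𝔼 𝔼) η :=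
    hasFDerivAt_prodMk_right x η
  exact ((hD (x, η) ⟨hx, hη⟩).comp η h).differentiableAt

theorem StructureConditions.continuous (hA : StructureConditions K p A) {x : 𝔼}
    (hx : x ∈ Kᶜ) : Continuous (A x) :=
  hA.continuousOn.comp_continuous (f := fun η : 𝔼 => (x, η)) (by fun_prop)
    fun _ => ⟨subset_closure hx, mem_univ _⟩

theorem fderiv_apply_eq_sum_partialEta (x η ξ : 𝔼) (j : Fin n) :
    (fderiv ℝ (A x) η ξ) j = ∑ i, ξ i * partialEta A x η i j := by
  conv_lhs => rw [← (EuclideanSpace.basisFun (Fin n) ℝ).sum_repr ξ]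
  simp [partialEta]

theorem inner_fderiv_eq_sum_partialEta (x η ξ : 𝔼) :
    inner ℝ (fderiv ℝ (A x) η ξ) ξ = ∑ i, ∑ j, partialEta A x η i j * ξ i * ξ j := by
  rw [PiLp.inner_apply, Finset.sum_comm]
  refine Finset.sum_congr rfl fun j _ => ?_
  rw [fderiv_apply_eq_sum_partialEta, real_inner_comm]
  simp only [RCLike.inner_apply, conj_trivial]
  rw [Finset.sum_mul]
  exact Finset.sum_congr rfl fun i _ => by ring

theorem norm_fderiv_apply_le (x η ξ : 𝔼) :
    ‖fderiv ℝ (A x) η ξ‖ ≤ (∑ i, ∑ j, |partialEta A x η i j|) * ‖ξ‖ := by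
  have hcoord : ∀ (v : 𝔼) i, |v i| ≤ ‖v‖ := fun v i => PiLp.norm_apply_le v i
  have hsum : ∀ v : 𝔼, ‖v‖ ≤ ∑ j, |v j| := by
    intro v
    conv_lhs => rw [← (EuclideanSpace.basisFun (Fin n) ℝ).sum_repr v]
    refine (norm_sum_le _ _).trans (Finset.sum_le_sum fun j _ => ?_)
    simp [norm_smul]
  refine (hsum _).trans ?_
  rw [Finset.sum_comm, Finset.sum_mul]
  refine Finset.sum_le_sum fun j _ => ?_
  rw [fderiv_apply_eq_sum_partialEta, Finset.sum_mul]
  refine (Finset.abs_sum_le_sum_abs _ _).trans (Finset.sum_le_sum fun i _ => ?_)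
  rw [abs_mul, mul_comm]
  exact mul_le_mul_of_nonneg_left (hcoord ξ i) (abs_nonneg _)

/-- The mean value theorem along the segment, in scalar form after pairing with `e`. `A x` need not
be differentiable at the origin, so the open segment must avoid it; at the endpoints continuity
suffices, which permits `a = 0`. -/
theorem StructureConditions.exists_inner_sub_eq (hA : StructureConditions K p A) {x : 𝔼}
    (hx : x ∈ Kᶜ) {a b : 𝔼} (hab : ∀ t ∈ Ioo (0 : ℝ) 1, a + t • (b - a) ≠ 0) (e : 𝔼) :
    ∃ t ∈ Ioo (0 : ℝ) 1, inner ℝ (A x b - A x a) e =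
      inner ℝ (fderiv ℝ (A x) (a + t • (b - a)) (b - a)) e := by
  have hline : ∀ t : ℝ, HasDerivAt (fun t : ℝ => a + t • (b - a)) (b - a) t := fun t => by
    simpa using ((hasDerivAt_id t).smul_const (b - a)).const_add a
  obtain ⟨t, ht, hteq⟩ := exists_hasDerivAt_eq_slope
    (fun t : ℝ => inner ℝ (A x (a + t • (b - a))) e)
    (fun t : ℝ => inner ℝ (fderiv ℝ (A x) (a + t • (b - a)) (b - a)) e) one_pos
    (by
      have := hA.continuous hx
      fun_prop)
    (fun t ht => by
      have h1 := (hA.differentiableAt hx (hab t ht)).hasFDerivAt.comp_hasDerivAt t (hline t)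
      simpa using h1.inner ℝ (hasDerivAt_const t e))
  refine ⟨t, ht, ?_⟩
  rw [hteq]
  simp [inner_sub_left]

/-- The vector field grows at most like `‖η‖ ^ (p - 1)`. -/
theorem StructureConditions.exists_norm_le (hA : StructureConditions K p A) (hp : 2 ≤ p) :
    ∃ C : ℝ, 0 < C ∧ ∀ x ∈ Kᶜ, ∀ η : 𝔼, ‖A x η‖ ≤ C * ‖η‖ ^ (p - 1) := by
  obtain ⟨Γ, hΓ, hgrowth⟩ := hA.growth
  refine ⟨Γ, hΓ, fun x hx η => ?_⟩
  rcases eq_or_ne η 0 with rfl | hη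
  · rw [hA.map_zero x hx, norm_zero]; positivity
  have hη0 : 0 < ‖η‖ := norm_pos_iff.2 hη
  -- Pairing with `A x η` itself turns the left side into `‖A x η‖ ^ 2`, from which one factor is
  -- cancelled at the end.
  obtain ⟨t, ht, heq⟩ := hA.exists_inner_sub_eq hx (a := 0) (b := η)
    (fun t ht => by simpa using ⟨ht.1.ne', hη⟩) (A x η)
  simp only [sub_zero, zero_add, hA.map_zero x hx, real_inner_self_eq_norm_sq] at heq
  have htη : t • η ≠ 0 := smul_ne_zero ht.1.ne' hη
  have hD : ‖fderiv ℝ (A x) (t • η) η‖ ≤ Γ * ‖η‖ ^ (p - 1) := by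
    refine (norm_fderiv_apply_le x _ η).trans ?_
    calc _ ≤ Γ * ‖t • η‖ ^ (p - 2) * ‖η‖ := by gcongr; exact hgrowth x hx _ htη
      _ ≤ Γ * ‖η‖ ^ (p - 2) * ‖η‖ := by
        gcongr
        rw [norm_smul, Real.norm_of_nonneg ht.1.le]
        exact mul_le_of_le_one_left (norm_nonneg _) ht.2.le
      _ = Γ * ‖η‖ ^ (p - 1) := by
        rw [mul_assoc, ← Real.rpow_add_one hη0.ne']; ring_nf
  rcases eq_or_ne (‖A x η‖) 0 with h0 | h0
  · rw [h0]; positivity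
  have hpos : 0 < ‖A x η‖ := lt_of_le_of_ne (norm_nonneg _) h0.symm
  refine le_of_mul_le_mul_right ?_ hpos
  calc ‖A x η‖ * ‖A x η‖ = inner ℝ (fderiv ℝ (A x) (t • η) η) (A x η) := by rw [← heq]; ring
    _ ≤ ‖fderiv ℝ (A x) (t • η) η‖ * ‖A x η‖ := real_inner_le_norm _ _
    _ ≤ _ := by gcongr

/-- The vector field is coercive. -/
theorem StructureConditions.exists_le_inner (hA : StructureConditions K p A) (hp : 2 ≤ p) :
    ∃ c : ℝ, 0 < c ∧ ∀ x ∈ Kᶜ, ∀ η : 𝔼, c * ‖η‖ ^ p ≤ inner ℝ (A x η) η := by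
  obtain ⟨γ, hγ, hell⟩ := hA.elliptic
  -- On the whole segment from `0` to `η` the mean value point could lie near `0`, where ellipticity
  -- degenerates. Only the half from `ζ = η / 2` to `η` is used, where norms are at least `‖ζ‖`; the
  -- other half contributes something nonnegative. Pairing with `ζ` gives `γ * ‖ζ‖ ^ p`, and `η = 2
  -- • ζ` supplies the factor `2`.
  refine ⟨2 * γ * (1 / 2) ^ p, by positivity, fun x hx η => ?_⟩
  rcases eq_or_ne η 0 with rfl | hη
  · simp [Real.zero_rpow (by linarith : p ≠ 0)]
  have hη0 : 0 < ‖η‖ := norm_pos_iff.2 hη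
  obtain ⟨ζ, hζ⟩ : ∃ ζ : 𝔼, ζ = (1 / 2 : ℝ) • η := ⟨_, rfl⟩
  have hζη : η = (2 : ℝ) • ζ := by rw [hζ, smul_smul]; norm_num
  have hζ0 : ζ ≠ 0 := hζ ▸ smul_ne_zero (by norm_num) hη
  have hsub : η - ζ = ζ := by rw [hζη]; module
  have hell' : ∀ ξ : 𝔼, ξ ≠ 0 → γ * ‖ζ‖ ^ 2 * ‖ξ‖ ^ (p - 2) ≤
      inner ℝ (fderiv ℝ (A x) ξ ζ) ζ := fun ξ hξ => by
    rw [inner_fderiv_eq_sum_partialEta]; exact hell x hx ξ hξ ζ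
  obtain ⟨t, ht, h1⟩ := hA.exists_inner_sub_eq hx (a := ζ) (b := η)
    (fun t ht => by
      rw [hsub, show ζ + t • ζ = (1 + t) • ζ by module]
      exact smul_ne_zero (by linarith [ht.1]) hζ0) ζ
  obtain ⟨s, hs, h2⟩ := hA.exists_inner_sub_eq hx (a := 0) (b := ζ)
    (fun t ht => by simpa using ⟨ht.1.ne', hζ0⟩) ζ
  simp only [sub_zero, zero_add, hA.map_zero x hx] at h2
  rw [hsub] at h1
  have h3 : 0 ≤ inner ℝ (A x ζ) ζ := by
    rw [h2]
    exact le_trans (by positivity) (hell' _ (smul_ne_zero hs.1.ne' hζ0))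
  have h4 : γ * ‖ζ‖ ^ p ≤ inner ℝ (A x η - A x ζ) ζ := by
    have hne : ζ + t • ζ ≠ 0 := by
      rw [show ζ + t • ζ = (1 + t) • ζ by module]
      exact smul_ne_zero (by linarith [ht.1]) hζ0
    rw [h1]
    refine le_trans ?_ (hell' _ hne)
    have hle : ‖ζ‖ ≤ ‖ζ + t • ζ‖ := by
      rw [show ζ + t • ζ = (1 + t) • ζ by module, norm_smul, Real.norm_of_nonneg
        (by linarith [ht.1])]
      nlinarith [ht.1, norm_nonneg ζ]
    have hζp : ‖ζ‖ ^ p = ‖ζ‖ ^ 2 * ‖ζ‖ ^ (p - 2) := by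
      rw [← Real.rpow_natCast, ← Real.rpow_add (norm_pos_iff.2 hζ0)]; norm_num
    rw [hζp, ← mul_assoc]
    gcongr
  have h5 : inner ℝ (A x η) η = 2 * inner ℝ (A x η) ζ := by
    conv_lhs => rw [hζη, inner_smul_right, ← hζη]
  have h6 : ‖ζ‖ ^ p = (1 / 2) ^ p * ‖η‖ ^ p := by
    rw [hζ, norm_smul, Real.mul_rpow (norm_nonneg _) (norm_nonneg _)]; norm_num
  rw [inner_sub_left] at h4
  rw [h5, mul_assoc, ← h6]
  nlinarith

/-- The vector field is strictly monotone. -/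
theorem StructureConditions.inner_sub_pos (hA : StructureConditions K p A) (hp : 2 ≤ p) {x : 𝔼}
    (hx : x ∈ Kᶜ) {a b : 𝔼} (hab : a ≠ b) : 0 < inner ℝ (A x b - A x a) (b - a) := by
  have hba : b - a ≠ 0 := sub_ne_zero.2 hab.symm
  by_cases h : ∀ t ∈ Ioo (0 : ℝ) 1, a + t • (b - a) ≠ 0
  · obtain ⟨γ, hγ, hell⟩ := hA.elliptic
    obtain ⟨t, ht, heq⟩ := hA.exists_inner_sub_eq hx h (b - a)
    rw [heq, inner_fderiv_eq_sum_partialEta]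
    refine lt_of_lt_of_le ?_ (hell x hx _ (h t ht) (b - a))
    have := norm_pos_iff.2 hba
    have := norm_pos_iff.2 (h t ht)
    positivity
  -- If the segment meets the origin, `a` and `b` are a nonpositive and a positive multiple of `b -
  -- a`. Coercivity at each of them then gives the sign of the corresponding term.
  · push Not at h
    obtain ⟨t, ht, h0⟩ := h
    obtain ⟨c, hc, hcoer⟩ := hA.exists_le_inner hp
    have ha : a = (-t) • (b - a) := by
      rw [neg_smul]; exact eq_neg_of_add_eq_zero_left h0
    have hb : b = (1 - t) • (b - a) := by
      rw [sub_smul, one_smul]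
      nth_rewrite 1 [show b = (b - a) + a by abel]
      nth_rewrite 2 [ha]
      module
    have ht1 : 0 < 1 - t := by linarith [ht.2]
    have hbpos : 0 < inner ℝ (A x b) b := by
      have hb0 : b ≠ 0 := by rw [hb]; exact smul_ne_zero ht1.ne' hba
      have := norm_pos_iff.2 hb0
      exact lt_of_lt_of_le (by positivity) (hcoer x hx b)
    have hapos : 0 ≤ inner ℝ (A x a) a := le_trans (by positivity) (hcoer x hx a)
    have e1 : inner ℝ (A x b) b = (1 - t) * inner ℝ (A x b) (b - a) := by
      rw [← inner_smul_right, ← hb]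
    have e2 : inner ℝ (A x a) a = (-t) * inner ℝ (A x a) (b - a) := by
      rw [← inner_smul_right, ← ha]
    rw [e1] at hbpos
    rw [e2] at hapos
    rw [inner_sub_left]
    have p1 : 0 < inner ℝ (A x b) (b - a) := by
      by_contra hcon; push Not at hcon; nlinarith
    have p2 : inner ℝ (A x a) (b - a) ≤ 0 := by
      by_contra hcon; push Not at hcon; nlinarith [ht.1]
    linarith

/-- Joint continuity on `Kᶜ × ℝⁿ` makes the extension of `A` by zero Borel, so it can be composed
with the measurable map `x ↦ (x, G x)`. -/
theorem StructureConditions.aestronglyMeasurable (hA : StructureConditions K p A)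
    (hK : IsOpen Kᶜ) {G : 𝔼 → 𝔼} (hG : AEStronglyMeasurable G (volume.restrict Kᶜ)) :
    AEStronglyMeasurable (fun x => A x (G x)) (volume.restrict Kᶜ) := by
  have hm : MeasurableSet (Kᶜ ×ˢ (univ : Set 𝔼)) := hK.measurableSet.prod .univ
  have h1 : Measurable ((Kᶜ ×ˢ (univ : Set 𝔼)).indicator (Function.uncurry A)) := by
    classical
    rw [← Set.piecewise_eq_indicator]
    exact (hA.continuousOn.mono (prod_mono subset_closure subset_rfl)).measurable_piecewise
      continuousOn_const hm
  have h2 : AEMeasurable (fun x => (x, G x)) (volume.restrict Kᶜ) :=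
    aemeasurable_id.prodMk hG.aemeasurable
  have h3 := (h1.comp_aemeasurable h2).aestronglyMeasurable
  refine h3.congr ?_
  refine (ae_restrict_iff' hK.measurableSet).2 (Eventually.of_forall fun x hx => ?_)
  simp only [Function.comp]
  rw [indicator_of_mem (show (x, G x) ∈ Kᶜ ×ˢ (univ : Set 𝔼) from ⟨hx, mem_univ _⟩)]
  rfl

/-- If `G ∈ L^p_loc`, then `A(x, G)` is in `L^q_loc` for the conjugate exponent `q`. -/
theorem StructureConditions.memLpLoc (hA : StructureConditions K p A) (hp : 2 ≤ p)
    (hK : IsOpen Kᶜ) {q : ℝ} (hpq : p.HolderConjugate q) {G : 𝔼 → 𝔼}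
    (hGm : AEStronglyMeasurable G (volume.restrict Kᶜ)) (hG : MemLpLoc Kᶜ p G) :
    MemLpLoc Kᶜ q (fun x => A x (G x)) := by
  obtain ⟨C, hC, hbd⟩ := hA.exists_norm_le hp
  intro S hS hSK
  -- `‖G‖ ^ (p - 1)` lies in `L^(p / (p - 1))`, and this exponent is `q`.
  have h1 := (hG S hS hSK).norm_rpow_div (ENNReal.ofReal (p - 1))
  rw [← ENNReal.ofReal_div_of_pos (by linarith), ENNReal.toReal_ofReal (by linarith),
    show p / (p - 1) = q from hpq.conjugate_eq.symm] at h1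
  refine h1.of_le_mul (c := C) ((hA.aestronglyMeasurable hK hGm).mono_measure
    (Measure.restrict_mono hSK le_rfl)) ?_
  refine (ae_restrict_iff' hS.measurableSet).2 (Eventually.of_forall fun x hx => ?_)
  rw [Real.norm_of_nonneg (by positivity)]
  exact hbd x (hSK hx) (G x)

end Structure

/-! ### Cutoff functions and elementary inequalities -/

section Cutoff

variable {n : ℕ}

local notation "𝔼" => EuclideanSpace ℝ (Fin n)

/-- A smooth bump function equal to `1` on the unit ball and supported in the ball of
radius `2`. -/
noncomputable def unitBump (n : ℕ) : ContDiffBump (0 : EuclideanSpace ℝ (Fin n)) :=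
  ⟨1, 2, one_pos, one_lt_two⟩

/-- The rescaled cutoff function, equal to `1` on the ball of radius `R` and supported in the ball
of radius `2 * R`. -/
noncomputable def cutoff (R : ℝ) (x : EuclideanSpace ℝ (Fin n)) : ℝ := unitBump n (R⁻¹ • x)

theorem contDiff_cutoff (R : ℝ) : ContDiff ℝ ∞ (cutoff R : 𝔼 → ℝ) :=
  (unitBump n).contDiff.comp (contDiff_const_smul _)

theorem cutoff_nonneg (R : ℝ) (x : 𝔼) : 0 ≤ cutoff R x := (unitBump n).nonneg

theorem cutoff_le_one (R : ℝ) (x : 𝔼) : cutoff R x ≤ 1 := (unitBump n).le_one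

theorem cutoff_eq_one {R : ℝ} (hR : 0 < R) {x : 𝔼} (hx : ‖x‖ ≤ R) : cutoff R x = 1 := by
  refine (unitBump n).one_of_mem_closedBall ?_
  rw [mem_closedBall_zero_iff, norm_smul, norm_inv, Real.norm_of_nonneg hR.le]
  exact (inv_mul_le_iff₀ hR).2 (by simpa [unitBump] using hx)

theorem cutoff_eq_zero {R : ℝ} (hR : 0 < R) {x : 𝔼} (hx : 2 * R ≤ ‖x‖) : cutoff R x = 0 := by
  refine (unitBump n).zero_of_le_dist ?_
  rw [dist_zero_right, norm_smul, norm_inv, Real.norm_of_nonneg hR.le, le_inv_mul_iff₀ hR]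
  simpa [unitBump, mul_comm] using hx

theorem tsupport_cutoff_subset {R : ℝ} (hR : 0 < R) :
    tsupport (cutoff R : 𝔼 → ℝ) ⊆ closedBall 0 (2 * R) := by
  refine closure_minimal (fun x hx => ?_) isClosed_closedBall
  rw [mem_closedBall_zero_iff]
  by_contra h
  exact hx (cutoff_eq_zero hR (not_le.1 h).le)

theorem hasCompactSupport_cutoff {R : ℝ} (hR : 0 < R) :
    HasCompactSupport (cutoff R : 𝔼 → ℝ) :=
  HasCompactSupport.of_support_subset_isCompact (isCompact_closedBall 0 (2 * R))
    ((subset_tsupport _).trans (tsupport_cutoff_subset hR))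

theorem gradient_cutoff (R : ℝ) (x : 𝔼) :
    ∇ (cutoff R) x = R⁻¹ • ∇ (unitBump n) (R⁻¹ • x) := by
  refine ext_inner_right ℝ fun e => ?_
  rw [inner_gradient_eq_fderiv, inner_smul_left, inner_gradient_eq_fderiv]
  have hd : HasFDerivAt (cutoff R : 𝔼 → ℝ) ((fderiv ℝ (unitBump n) (R⁻¹ • x)).comp
      (R⁻¹ • ContinuousLinearMap.id ℝ 𝔼)) x :=
    (((unitBump n).contDiff (n := 1)).differentiable (by simp) _).hasFDerivAt.comp x
      ((hasFDerivAt_id x).const_smul R⁻¹)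
  rw [hd.fderiv]
  simp

theorem gradient_cutoff_eq_zero {R : ℝ} (hR : 0 < R) {x : 𝔼} (hx : ‖x‖ < R) :
    ∇ (cutoff R) x = 0 := by
  have hev : (cutoff R : 𝔼 → ℝ) =ᶠ[𝓝 x] fun _ => 1 := by
    filter_upwards [isOpen_ball.mem_nhds (mem_ball_zero_iff.2 hx)] with y hy
    exact cutoff_eq_one hR (mem_ball_zero_iff.1 hy).le
  rw [gradient, hev.fderiv_eq]
  simp

theorem integrable_norm_gradient_rpow {φ : 𝔼 → ℝ} (hφ : ContDiff ℝ ∞ φ)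
    (hφc : HasCompactSupport φ) {p : ℝ} (hp : 0 < p) :
    Integrable (fun x => ‖∇ φ x‖ ^ p) volume := by
  have hc := continuous_gradient hφ
  refine Continuous.integrable_of_hasCompactSupport
    (hc.norm.rpow_const fun x => Or.inr hp.le) ?_
  refine HasCompactSupport.of_support_subset_isCompact hφc.isCompact fun x hx => ?_
  by_contra h
  exact hx (by simp [gradient_eq_zero_of_notMem_tsupport h, Real.zero_rpow hp.ne'])

/-- For `p ≥ n`, the cutoff functions have uniformly bounded `p`-energy. -/
theorem integral_norm_gradient_cutoff_le {p : ℝ} (hp : (n : ℝ) ≤ p) {R : ℝ} (hR : 1 ≤ R) :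
    ∫ x : 𝔼, ‖∇ (cutoff R) x‖ ^ p ≤ ∫ x, ‖∇ (unitBump n) x‖ ^ p := by
  have hR0 : 0 < R := by linarith
  have hpt : ∀ x : 𝔼, ‖∇ (cutoff R) x‖ ^ p =
      R⁻¹ ^ p * (fun y => ‖∇ (unitBump n) y‖ ^ p) (R⁻¹ • x) := fun x => by
    rw [gradient_cutoff, norm_smul, Real.mul_rpow (norm_nonneg _) (norm_nonneg _), norm_inv,
      Real.norm_of_nonneg hR0.le]
  rw [integral_congr_ae (Eventually.of_forall hpt), integral_const_mul,
    Measure.integral_comp_inv_smul volume (fun y : 𝔼 => ‖∇ (unitBump n) y‖ ^ p),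
    smul_eq_mul, ← mul_assoc]
  -- The change of variables leaves the factor `R ^ (n - p)`, at most `1` since `R ≥ 1` and `n ≤ p`.
  refine mul_le_of_le_one_left (integral_nonneg fun x => by positivity) ?_
  rw [abs_of_nonneg (by positivity), finrank_euclideanSpace_fin, ← Real.rpow_natCast,
    Real.inv_rpow hR0.le, inv_mul_le_iff₀ (by positivity), mul_one]
  exact Real.rpow_le_rpow_of_exponent_le hR hp

/-- A weighted Young inequality. Sharp constants are not needed, so comparing `b` with `δ * a` is
enough: one of the two terms on the right already dominates. -/
theorem rpow_mul_le_add {p a b δ : ℝ} (hp : 1 < p) (ha : 0 ≤ a) (hb : 0 ≤ b) (hδ : 0 < δ) :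
    a ^ (p - 1) * b ≤ δ * a ^ p + δ ^ (1 - p) * b ^ p := by
  have hsplit : ∀ {c : ℝ}, 0 ≤ c → c ^ p = c ^ (p - 1) * c := fun {c} hc => by
    rw [← Real.rpow_add_one' hc (by linarith)]; ring_nf
  rcases le_total b (δ * a) with h | h
  · have : a ^ (p - 1) * b ≤ δ * a ^ p := by
      rw [hsplit ha]
      calc a ^ (p - 1) * b ≤ a ^ (p - 1) * (δ * a) := by gcongr
        _ = _ := by ring
    have : 0 ≤ δ ^ (1 - p) * b ^ p := by positivity
    linarith
  · have : a ^ (p - 1) * b ≤ δ ^ (1 - p) * b ^ p := by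
      have h1 : a ≤ δ⁻¹ * b := by rwa [le_inv_mul_iff₀ hδ]
      calc a ^ (p - 1) * b ≤ (δ⁻¹ * b) ^ (p - 1) * b := by
            gcongr
        _ = δ ^ (1 - p) * b ^ p := by
            rw [Real.mul_rpow (by positivity) hb, hsplit hb, Real.inv_rpow hδ.le,
              ← Real.rpow_neg hδ.le]
            ring_nf
    have : 0 ≤ δ * a ^ p := by positivity
    linarith

theorem add_rpow_le {p a b : ℝ} (hp : 0 ≤ p) (ha : 0 ≤ a) (hb : 0 ≤ b) :
    (a + b) ^ p ≤ 2 ^ p * (a ^ p + b ^ p) := by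
  have key : ∀ {c d : ℝ}, 0 ≤ c → c ≤ d → (c + d) ^ p ≤ 2 ^ p * d ^ p := fun {c d} hc hcd => by
    rw [← Real.mul_rpow (by norm_num) (hc.trans hcd)]
    exact Real.rpow_le_rpow (by linarith) (by linarith) hp
  have hap : 0 ≤ a ^ p := by positivity
  have hbp : 0 ≤ b ^ p := by positivity
  have h2 : (0 : ℝ) < 2 ^ p := by positivity
  rcases le_total a b with h | h
  · refine (key ha h).trans ?_
    gcongr
    linarith
  · rw [add_comm]
    refine (key hb h).trans ?_
    gcongr
    linarith

end Cutoff

/-! ### Finite energy at infinity -/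

section Caccioppoli

variable {n : ℕ} {K : Set (EuclideanSpace ℝ (Fin n))} {p : ℝ}
  {A : EuclideanSpace ℝ (Fin n) → EuclideanSpace ℝ (Fin n) → EuclideanSpace ℝ (Fin n)}

local notation "𝔼" => EuclideanSpace ℝ (Fin n)

theorem MemLpLoc.integrableOn_norm_rpow {Ω : Set 𝔼} {G : 𝔼 → 𝔼} (hp : 0 < p)
    (hG : MemLpLoc Ω p G) {C : Set 𝔼} (hC : IsCompact C) (hCΩ : C ⊆ Ω) :
    IntegrableOn (fun x => ‖G x‖ ^ p) C volume := by
  have := (hG C hC hCΩ).integrable_norm_rpow (by simpa using hp) (by simp)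
  rwa [ENNReal.toReal_ofReal hp.le] at this

theorem locallyIntegrableOn_compl (hK : IsClosed K) {f : 𝔼 → ℝ}
    (hf : ∀ U, IsOpen U → K ⊆ U → IntegrableOn f Uᶜ volume) :
    LocallyIntegrableOn f Kᶜ volume := by
  rw [locallyIntegrableOn_iff hK.isOpen_compl.isLocallyClosed]
  intro C hCK hC
  have := hf Cᶜ hC.isClosed.isOpen_compl (subset_compl_comm.1 hCK)
  rwa [compl_compl] at this

/-- Energy estimate at infinity: a bounded weak solution with integrable right-hand side has finite
`p`-energy outside a ball. -/
theorem exists_integrableOn_norm_gradient_rpow (hp2 : 2 ≤ p) (hpn : (n : ℝ) ≤ p)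
    (hK : IsCompact K) (hA : StructureConditions K p A) {u f : 𝔼 → ℝ} {G : 𝔼 → 𝔼} {M : ℝ}
    (hu : ContinuousOn u Kᶜ) (hM : ∀ x ∈ Kᶜ, |u x| ≤ M)
    (hf : ∀ U, IsOpen U → K ⊆ U → IntegrableOn f Uᶜ volume)
    (hG : HasWeakGradient Kᶜ u G) (hGp : MemLpLoc Kᶜ p G)
    (hsol : ∀ φ, IsTestFunction Kᶜ φ →
      ∫ x in Kᶜ, inner ℝ (A x (G x)) (∇ φ x) = ∫ x in Kᶜ, f x * φ x) :
    ∃ R₀ : ℝ, IntegrableOn (fun x => ‖G x‖ ^ p) {x | R₀ ≤ ‖x‖} volume := by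
  have hKo : IsOpen Kᶜ := hK.isClosed.isOpen_compl
  have hp1 : 1 < p := by linarith
  have hp0 : 0 < p := by linarith
  have hpq : p.HolderConjugate p.conjExponent := Real.HolderConjugate.conjExponent hp1
  obtain ⟨C, hC, hgrowth⟩ := hA.exists_norm_le hp2
  obtain ⟨c, hc, hcoer⟩ := hA.exists_le_inner hp2
  obtain ⟨R₁, hR₁, hKR⟩ : ∃ R₁ : ℝ, 1 ≤ R₁ ∧ K ⊆ ball 0 R₁ := by
    obtain ⟨r, hr⟩ := hK.isBounded.subset_ball (0 : 𝔼)
    exact ⟨max 1 r, le_max_left _ _, hr.trans (ball_subset_ball (le_max_right _ _))⟩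
  have hR₁0 : 0 < R₁ := by linarith
  have hB : MemLpLoc Kᶜ p.conjExponent (fun x => A x (G x)) :=
    hA.memLpLoc hp2 hKo hpq hG.locallyIntegrable_grad.aestronglyMeasurable hGp
  -- An integer power keeps `ψ ^ m` smooth, and `m ≥ p` lets `ψ ^ (m - 1)` contain the factor `ψ ^
  -- (p - 1)` needed in Young's inequality.
  obtain ⟨m, hm⟩ := exists_nat_ge p
  have hm2 : (2 : ℝ) ≤ m := hp2.trans hm
  have hm0 : 0 < m := by exact_mod_cast (by linarith : (0 : ℝ) < m)
  set N := ∫ x : 𝔼, ‖∇ (unitBump n) x‖ ^ p with hN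
  set M' := max M 0 with hM'
  have hM'0 : 0 ≤ M' := le_max_right _ _
  have hMu : ∀ x ∈ Kᶜ, |u x| ≤ M' := fun x hx => (hM x hx).trans (le_max_left _ _)
  set L := M' * m * C with hL
  have hL0 : 0 ≤ L := by positivity
  -- Chosen so that the gradient term from Young's inequality is at most half the coercive term and
  -- can be absorbed. The `+ 1` covers `L = 0`.
  set δ := c / (2 * (L + 1)) with hδ
  have hδ0 : 0 < δ := by positivity
  have hLδ : L * δ ≤ c / 2 := by
    rw [hδ, mul_div_assoc', div_le_div_iff₀ (by positivity) (by norm_num)]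
    nlinarith
  have hfI : IntegrableOn f (ball 0 R₁)ᶜ volume := hf _ isOpen_ball hKR
  set F := ∫ x in (ball (0 : 𝔼) R₁)ᶜ, |f x| with hF
  -- the annular cutoff functions
  let ψ : ℝ → 𝔼 → ℝ := fun R x => cutoff R x * (1 - cutoff R₁ x)
  have hψs : ∀ R, ContDiff ℝ ∞ (ψ R) := fun R =>
    (contDiff_cutoff R).mul (contDiff_const.sub (contDiff_cutoff R₁))
  have hψ0 : ∀ R x, 0 ≤ ψ R x := fun R x =>
    mul_nonneg (cutoff_nonneg R x) (by linarith [cutoff_le_one R₁ x])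
  have hψ1 : ∀ R x, ψ R x ≤ 1 := fun R x =>
    mul_le_one₀ (cutoff_le_one R x) (by linarith [cutoff_le_one R₁ x])
      (by linarith [cutoff_nonneg R₁ x])
  have hψz : ∀ R, ∀ x ∈ ball (0 : 𝔼) R₁, ψ R x = 0 := fun R x hx => by
    simp [ψ, cutoff_eq_one hR₁0 (mem_ball_zero_iff.1 hx).le]
  have hψt : ∀ R, 0 < R → IsTestFunction Kᶜ (fun x => ψ R x ^ m) := by
    intro R hR
    have hts : tsupport (fun x => ψ R x ^ m) ⊆ (ball 0 R₁)ᶜ := by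
      refine closure_minimal (fun x hx hxb => hx ?_) isOpen_ball.isClosed_compl
      simp [hψz R x hxb, hm0.ne']
    refine ⟨(hψs R).pow m, ?_, hts.trans (compl_subset_compl.2 hKR)⟩
    refine HasCompactSupport.of_support_subset_isCompact (isCompact_closedBall (0 : 𝔼) (2 * R)) ?_
    intro x hx
    rw [mem_closedBall_zero_iff]
    by_contra h
    exact hx (by simp [ψ, cutoff_eq_zero hR (not_le.1 h).le, hm0.ne'])
  have hgψ : ∀ R x, ∇ (fun x => ψ R x ^ m) x = (m * ψ R x ^ (m - 1)) • ∇ (ψ R) x := by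
    intro R x
    have := gradient_comp (h := fun t : ℝ => t ^ m) (f := ψ R) (x := x)
      (by fun_prop) ((hψs R).differentiable (by simp) x)
    rw [this]; simp
  have hgn : ∀ R x, ‖∇ (ψ R) x‖ ^ p ≤
      2 ^ p * (‖∇ (cutoff R) x‖ ^ p + ‖∇ (cutoff R₁) x‖ ^ p) := by
    intro R x
    refine le_trans (Real.rpow_le_rpow (norm_nonneg _) ?_ hp0.le)
      (add_rpow_le hp0.le (norm_nonneg _) (norm_nonneg _))
    have hd : DifferentiableAt ℝ (cutoff R₁ : 𝔼 → ℝ) x :=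
      (contDiff_cutoff R₁).differentiable (by simp) x
    have h1 : ∇ (fun y : 𝔼 => 1 - cutoff R₁ y) x = - ∇ (cutoff R₁) x := by
      refine ext_inner_right ℝ fun e => ?_
      rw [inner_gradient_eq_fderiv, fderiv_const_sub, inner_neg_left, inner_gradient_eq_fderiv]
      simp
    have h2 : ∇ (ψ R) x = cutoff R x • (- ∇ (cutoff R₁) x) +
        (1 - cutoff R₁ x) • ∇ (cutoff R) x := by
      rw [← h1]
      exact gradient_mul ((contDiff_cutoff R).differentiable (by simp) x) (hd.const_sub 1)
    rw [h2, add_comm]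
    refine (norm_add_le _ _).trans (add_le_add ?_ ?_)
    · rw [norm_smul, Real.norm_of_nonneg (by linarith [cutoff_le_one R₁ x])]
      exact mul_le_of_le_one_left (norm_nonneg _) (by linarith [cutoff_nonneg R₁ x])
    · rw [norm_smul, norm_neg, Real.norm_of_nonneg (cutoff_nonneg R x)]
      exact mul_le_of_le_one_left (norm_nonneg _) (cutoff_le_one R x)
  have hcutI : ∀ R, 0 < R → Integrable (fun x : 𝔼 => ‖∇ (cutoff R) x‖ ^ p) volume := fun R hR =>
    integrable_norm_gradient_rpow (contDiff_cutoff R) (hasCompactSupport_cutoff hR) hp0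
  have hGI : ∀ R, 0 < R → IntegrableOn (fun x => ψ R x ^ m * ‖G x‖ ^ p) Kᶜ volume := by
    intro R hR
    have ht := hψt R hR
    have h1 := (hGp.integrableOn_norm_rpow hp0 ht.compact_support.isCompact
      ht.support_subset).continuousOn_mul ht.smooth.continuous.continuousOn
      ht.compact_support.isCompact
    refine (h1.integrable_of_forall_notMem_eq_zero fun x hx => ?_).integrableOn
    rw [image_eq_zero_of_notMem_tsupport hx, zero_mul]
  -- the uniform energy bound
  have henergy : ∀ R, 1 ≤ R → ∫ x in Kᶜ, ψ R x ^ m * ‖G x‖ ^ p ≤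
      2 / c * (M' * F + L * δ ^ (1 - p) * (2 ^ p * (N + N))) := by
    intro R hR
    have hR0 : 0 < R := by linarith
    -- The classical Caccioppoli test function `u ψ ^ m`, obtained with `h` the identity.
    obtain ⟨hI1, hI2, hI3, heq⟩ := testing_with_comp_mul hKo hpq hB
      (locallyIntegrableOn_compl hK.isClosed hf) hsol hu hG hGp (h := fun t => t) contDiff_id
      (hψt R hR0)
    simp only [deriv_id'', mul_one] at hI1 hI2 hI3 heq
    have hlow : c * ∫ x in Kᶜ, ψ R x ^ m * ‖G x‖ ^ p ≤
        ∫ x in Kᶜ, ψ R x ^ m * inner ℝ (A x (G x)) (G x) := by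
      rw [← integral_const_mul]
      refine setIntegral_mono_on ((hGI R hR0).const_mul c) hI1 hKo.measurableSet fun x hx => ?_
      have := hcoer x hx (G x)
      have h0 : 0 ≤ ψ R x ^ m := pow_nonneg (hψ0 R x) m
      calc c * (ψ R x ^ m * ‖G x‖ ^ p) = ψ R x ^ m * (c * ‖G x‖ ^ p) := by ring
        _ ≤ _ := by gcongr
    have hright : ∫ x in Kᶜ, u x * ψ R x ^ m * f x ≤ M' * F := by
      have hz : ∫ x in Kᶜ, u x * ψ R x ^ m * f x =
          ∫ x in (ball (0 : 𝔼) R₁)ᶜ, u x * ψ R x ^ m * f x := by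
        refine (setIntegral_eq_of_subset_of_forall_sdiff_eq_zero hKo.measurableSet
          (compl_subset_compl.2 hKR) fun x hx => ?_)
        have hxb : x ∈ ball (0 : 𝔼) R₁ := notMem_compl_iff.1 hx.2
        simp [hψz R x hxb, hm0.ne']
      rw [hz, hF, ← integral_const_mul]
      refine setIntegral_mono_on (hI3.mono_set (compl_subset_compl.2 hKR))
        (hfI.abs.const_mul M') isOpen_ball.measurableSet.compl fun x hx => ?_
      refine (le_abs_self _).trans ?_
      rw [abs_mul, abs_mul, abs_of_nonneg (pow_nonneg (hψ0 R x) m)]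
      have h1 : |u x| * ψ R x ^ m ≤ M' * 1 :=
        mul_le_mul (hMu x (compl_subset_compl.2 hKR hx)) (pow_le_one₀ (hψ0 R x) (hψ1 R x))
          (pow_nonneg (hψ0 R x) m) hM'0
      rw [mul_one] at h1
      gcongr
    have hmid : -∫ x in Kᶜ, u x * inner ℝ (A x (G x)) (∇ (fun x => ψ R x ^ m) x) ≤
        c / 2 * (∫ x in Kᶜ, ψ R x ^ m * ‖G x‖ ^ p) +
          L * δ ^ (1 - p) * (2 ^ p * (N + N)) := by
      set E : 𝔼 → ℝ := fun x => ‖∇ (cutoff R) x‖ ^ p + ‖∇ (cutoff R₁) x‖ ^ p with hE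
      have hEI : Integrable E volume := (hcutI R hR0).add (hcutI R₁ hR₁0)
      have hEN : ∫ x in Kᶜ, E x ≤ N + N := by
        refine (setIntegral_le_integral hEI
          (Eventually.of_forall fun x => by simp only [hE, Pi.zero_apply]; positivity)).trans ?_
        rw [hE, integral_add (hcutI R hR0) (hcutI R₁ hR₁0)]
        exact add_le_add (integral_norm_gradient_cutoff_le hpn hR)
          (integral_norm_gradient_cutoff_le hpn hR₁)
      have hle : -∫ x in Kᶜ, u x * inner ℝ (A x (G x)) (∇ (fun x => ψ R x ^ m) x) ≤
          ∫ x in Kᶜ, (c / 2 * (ψ R x ^ m * ‖G x‖ ^ p) +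
            L * δ ^ (1 - p) * 2 ^ p * E x) := by
        rw [← integral_neg]
        refine setIntegral_mono_on hI2.neg (((hGI R hR0).const_mul _).add
          (hEI.integrableOn.const_mul _)) hKo.measurableSet fun x hx => ?_
        have hψx := hψ0 R x
        have hψx1 := hψ1 R x
        have hstep1 : -(u x * inner ℝ (A x (G x)) (∇ (fun x => ψ R x ^ m) x)) ≤
            L * (ψ R x ^ (m - 1) * ‖G x‖ ^ (p - 1) * ‖∇ (ψ R) x‖) := by
          refine (neg_le_abs _).trans ?_
          rw [abs_mul]
          have h1 : |inner ℝ (A x (G x)) (∇ (fun x => ψ R x ^ m) x)| ≤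
              (C * ‖G x‖ ^ (p - 1)) * (m * ψ R x ^ (m - 1) * ‖∇ (ψ R) x‖) := by
            refine (abs_real_inner_le_norm _ _).trans ?_
            rw [hgψ, norm_smul, Real.norm_of_nonneg (by positivity)]
            gcongr
            exact hgrowth x hx (G x)
          calc _ ≤ M' * ((C * ‖G x‖ ^ (p - 1)) * (m * ψ R x ^ (m - 1) * ‖∇ (ψ R) x‖)) :=
                mul_le_mul (hMu x hx) h1 (abs_nonneg _) hM'0
            _ = _ := by rw [hL]; ring
        -- Young's inequality with `a = ψ ‖G‖` and `b = ‖∇ψ‖`, multiplied by `ψ ^ (m - p) ≤ 1`.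
        have hstep2 : ψ R x ^ (m - 1) * ‖G x‖ ^ (p - 1) * ‖∇ (ψ R) x‖ ≤
            δ * (ψ R x ^ m * ‖G x‖ ^ p) + δ ^ (1 - p) * ‖∇ (ψ R) x‖ ^ p := by
          have hr : ∀ s : ℝ, 0 < s → ψ R x ^ ((m : ℝ) - p + s) =
              ψ R x ^ ((m : ℝ) - p) * ψ R x ^ s := fun s hs =>
            Real.rpow_add_of_nonneg hψx (by linarith) hs.le
          have e1 : ψ R x ^ m = ψ R x ^ ((m : ℝ) - p) * ψ R x ^ p := by
            rw [← hr p hp0, sub_add_cancel, Real.rpow_natCast]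
          have e2 : ψ R x ^ (m - 1) = ψ R x ^ ((m : ℝ) - p) * ψ R x ^ (p - 1) := by
            rw [← hr (p - 1) (by linarith), ← Real.rpow_natCast, Nat.cast_pred hm0]
            ring_nf
          have hy := rpow_mul_le_add hp1 (mul_nonneg hψx (norm_nonneg (G x)))
            (norm_nonneg (∇ (ψ R) x)) hδ0
          rw [Real.mul_rpow hψx (norm_nonneg _), Real.mul_rpow hψx (norm_nonneg _)] at hy
          have hw1 : ψ R x ^ ((m : ℝ) - p) ≤ 1 := Real.rpow_le_one hψx hψx1 (by linarith)
          have hw0 : 0 ≤ ψ R x ^ ((m : ℝ) - p) := Real.rpow_nonneg hψx _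
          have hD0 : 0 ≤ δ ^ (1 - p) * ‖∇ (ψ R) x‖ ^ p := by positivity
          rw [e1, e2]
          have := mul_le_mul_of_nonneg_left hy hw0
          have := mul_le_of_le_one_left hD0 hw1
          linarith
        have hX : 0 ≤ ψ R x ^ m * ‖G x‖ ^ p := by positivity
        have hY : 0 ≤ L * δ ^ (1 - p) := by positivity
        have h3 := mul_le_mul_of_nonneg_left hstep2 hL0
        have h4 := mul_le_mul_of_nonneg_left (hgn R x) hY
        have h5 := mul_le_mul_of_nonneg_right hLδ hX
        simp only [hE]
        linarith
      refine hle.trans ?_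
      rw [integral_add ((hGI R hR0).const_mul _) (hEI.integrableOn.const_mul _),
        integral_const_mul, integral_const_mul]
      have h6 : L * δ ^ (1 - p) * 2 ^ p * ∫ x in Kᶜ, E x ≤
          L * δ ^ (1 - p) * 2 ^ p * (N + N) := by
        have : 0 ≤ L * δ ^ (1 - p) * 2 ^ p := by positivity
        exact mul_le_mul_of_nonneg_left hEN this
      linarith
    rw [div_mul_eq_mul_div, le_div_iff₀ hc]
    linarith
  -- For `2 * R₁ ≤ ‖x‖ ≤ k` the inner cutoff is `0` and the outer one is `1`, so `ψ k = 1` there.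
  -- The energy bound does not depend on `k`, and exhausting by balls gives integrability.
  refine ⟨2 * R₁, ?_⟩
  have hcov : AECover (volume.restrict {x : 𝔼 | 2 * R₁ ≤ ‖x‖}) atTop
      (fun k : ℕ => closedBall (0 : 𝔼) k) :=
    aecover_closedBall tendsto_natCast_atTop_atTop
  have hfar : {x : 𝔼 | 2 * R₁ ≤ ‖x‖} ⊆ Kᶜ := fun x hx hxK => by
    have := mem_ball_zero_iff.1 (hKR hxK)
    have hx' : 2 * R₁ ≤ ‖x‖ := hx
    linarith
  have hfarm : MeasurableSet {x : 𝔼 | 2 * R₁ ≤ ‖x‖} :=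
    (isClosed_le continuous_const continuous_norm).measurableSet
  have hann : ∀ k : ℕ, IntegrableOn (fun x => ‖G x‖ ^ p)
      (closedBall (0 : 𝔼) k ∩ {x : 𝔼 | 2 * R₁ ≤ ‖x‖}) volume := fun k =>
    hGp.integrableOn_norm_rpow hp0 ((isCompact_closedBall 0 _).inter_right
      (isClosed_le continuous_const continuous_norm)) (inter_subset_right.trans hfar)
  refine hcov.integrable_of_integral_bounded_of_nonneg_ae
    (2 / c * (M' * F + L * δ ^ (1 - p) * (2 ^ p * (N + N)))) (fun k => ?_)
    (Eventually.of_forall fun x => by positivity) ?_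
  · rw [IntegrableOn, Measure.restrict_restrict measurableSet_closedBall]
    exact hann k
  · filter_upwards [eventually_ge_atTop 1] with k hk
    have hk1 : (1 : ℝ) ≤ k := by exact_mod_cast hk
    rw [Measure.restrict_restrict measurableSet_closedBall]
    refine le_trans ?_ (henergy k hk1)
    calc ∫ x in closedBall (0 : 𝔼) k ∩ {x : 𝔼 | 2 * R₁ ≤ ‖x‖}, ‖G x‖ ^ p
        = ∫ x in closedBall (0 : 𝔼) k ∩ {x : 𝔼 | 2 * R₁ ≤ ‖x‖}, ψ k x ^ m * ‖G x‖ ^ p := by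
          refine setIntegral_congr_fun (measurableSet_closedBall.inter hfarm) fun x hx => ?_
          have h1 : ψ k x = 1 := by
            simp [ψ, cutoff_eq_zero hR₁0 hx.2,
              cutoff_eq_one (by linarith : (0 : ℝ) < k) (mem_closedBall_zero_iff.1 hx.1)]
          simp [h1]
      _ ≤ ∫ x in Kᶜ, ψ k x ^ m * ‖G x‖ ^ p :=
          setIntegral_mono_set (hGI k (by linarith))
            (Eventually.of_forall fun x => by
              have := hψ0 k x
              simp only [Pi.zero_apply]; positivity)
            (LE.le.eventuallyLE (inter_subset_right.trans hfar))

end Caccioppoli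

/-! ### The energy argument for the difference of two solutions -/

section Comparison

variable {n : ℕ} {K : Set (EuclideanSpace ℝ (Fin n))} {p : ℝ}
  {A : EuclideanSpace ℝ (Fin n) → EuclideanSpace ℝ (Fin n) → EuclideanSpace ℝ (Fin n)}

local notation "𝔼" => EuclideanSpace ℝ (Fin n)

/-- Multiplication by `ζ` makes a test function vanish near `K`. Being `1` on a neighbourhood of
each point of `S`, not only on `S`, it leaves gradients there unchanged. -/
theorem exists_smooth_separation {S : Set 𝔼} (hK : IsClosed K) (hS : IsClosed S)
    (hd : Disjoint K S) :
    ∃ ζ : 𝔼 → ℝ, ContDiff ℝ ∞ ζ ∧ (∀ x, 0 ≤ ζ x) ∧ tsupport ζ ⊆ Kᶜ ∧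
      (∀ x ∈ S, ζ =ᶠ[𝓝 x] fun _ => 1) := by
  obtain ⟨f, hf0, hf1, hf⟩ := exists_contMDiffMap_zero_one_nhds_of_isClosed
    (n := (⊤ : ℕ∞)) (modelWithCornersSelf ℝ 𝔼) hK hS hd
  refine ⟨f, f.contMDiff.contDiff, fun x => (hf x).1, fun x hx hxK => ?_, fun x hx => ?_⟩
  · exact notMem_tsupport_iff_eventuallyEq.2 ((eventually_nhdsSet_iff_forall.1 hf0) x hxK) hx
  · exact (eventually_nhdsSet_iff_forall.1 hf1) x hx

theorem gradient_mul_eq_of_eventuallyEq_one {φ ζ : 𝔼 → ℝ} {x : 𝔼}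
    (hζ : ζ =ᶠ[𝓝 x] fun _ => 1) : ∇ (fun y => φ y * ζ y) x = ∇ φ x := by
  have : (fun y => φ y * ζ y) =ᶠ[𝓝 x] φ := by
    filter_upwards [hζ] with y hy
    rw [hy, mul_one]
  rw [gradient, gradient, this.fderiv_eq]

theorem isTestFunction_mul {Ω : Set 𝔼} {φ ζ : 𝔼 → ℝ} (hφ : ContDiff ℝ ∞ φ)
    (hφc : HasCompactSupport φ) (hζ : ContDiff ℝ ∞ ζ) (hζΩ : tsupport ζ ⊆ Ω) :
    IsTestFunction Ω (fun x => φ x * ζ x) :=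
  ⟨hφ.mul hζ, hφc.mul_right,
    (closure_mono (Function.support_mul_subset_right _ _)).trans hζΩ⟩

theorem tendsto_setIntegral_norm_ge {g : 𝔼 → ℝ} {R₀ : ℝ}
    (hg : IntegrableOn g {x | R₀ ≤ ‖x‖} volume) :
    Tendsto (fun k : ℕ => ∫ x in {x : 𝔼 | (k : ℝ) ≤ ‖x‖}, g x) atTop (𝓝 0) := by
  obtain ⟨k₀, hk₀⟩ := exists_nat_ge R₀
  have h := tendsto_setIntegral_of_antitone (μ := volume) (f := g)
    (s := fun k : ℕ => {x : 𝔼 | (k : ℝ) ≤ ‖x‖})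
    (fun k => (isClosed_le continuous_const continuous_norm).measurableSet)
    (fun i j hij x hx => le_trans (by exact_mod_cast hij) (show (j : ℝ) ≤ ‖x‖ from hx))
    ⟨k₀, hg.mono_set fun x hx => hk₀.trans hx⟩
  have hempty : ⋂ k : ℕ, {x : 𝔼 | (k : ℝ) ≤ ‖x‖} = ∅ := by
    refine eq_empty_of_forall_notMem fun x hx => ?_
    obtain ⟨k, hk⟩ := exists_nat_gt ‖x‖
    exact absurd (mem_iInter.1 hx k) (not_le.2 hk)
  simpa [hempty] using h

set_option maxHeartbeats 1000000 in
/-- The main energy argument: for a monotone truncation `h` supported away from the boundary,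
the truncated difference `h(u - v)` has zero gradient. -/
theorem ae_deriv_smul_sub_eq_zero (hp2 : 2 ≤ p) (hpn : (n : ℝ) ≤ p)
    (hK : IsCompact K) (hA : StructureConditions K p A) {u v f₁ f₂ : 𝔼 → ℝ} {Gu Gv : 𝔼 → 𝔼}
    (hu : ContinuousOn u Kᶜ) (hv : ContinuousOn v Kᶜ)
    (hu_bdd : ∃ M : ℝ, ∀ x ∈ Kᶜ, |u x| ≤ M) (hv_bdd : ∃ M : ℝ, ∀ x ∈ Kᶜ, |v x| ≤ M)
    (hf₁ : ∀ U, IsOpen U → K ⊆ U → IntegrableOn f₁ Uᶜ volume)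
    (hf₂ : ∀ U, IsOpen U → K ⊆ U → IntegrableOn f₂ Uᶜ volume)
    (hf : ∀ᵐ x ∂volume.restrict Kᶜ, f₁ x ≤ f₂ x)
    (hGu : HasWeakGradient Kᶜ u Gu) (hGv : HasWeakGradient Kᶜ v Gv)
    (hGup : MemLpLoc Kᶜ p Gu) (hGvp : MemLpLoc Kᶜ p Gv)
    (hu_sol : ∀ φ, IsTestFunction Kᶜ φ →
      ∫ x in Kᶜ, inner ℝ (A x (Gu x)) (∇ φ x) = ∫ x in Kᶜ, f₁ x * φ x)
    (hv_sol : ∀ φ, IsTestFunction Kᶜ φ →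
      ∫ x in Kᶜ, inner ℝ (A x (Gv x)) (∇ φ x) = ∫ x in Kᶜ, f₂ x * φ x)
    {h : ℝ → ℝ} (hh : ContDiff ℝ ∞ h) (hmono : Monotone h) (hh0 : ∀ t, 0 ≤ h t)
    (hh1 : ∀ t, h t ≤ 1) {ζ : 𝔼 → ℝ} (hζ : ContDiff ℝ ∞ ζ) (hζ0 : ∀ x, 0 ≤ ζ x)
    (hζK : tsupport ζ ⊆ Kᶜ)
    (hζ1 : ∀ x ∈ Kᶜ, h (u x - v x) ≠ 0 ∨ deriv h (u x - v x) ≠ 0 → ζ =ᶠ[𝓝 x] fun _ => 1) :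
    ∀ᵐ x ∂volume.restrict Kᶜ, deriv h (u x - v x) • (Gu x - Gv x) = 0 := by
  have hKo : IsOpen Kᶜ := hK.isClosed.isOpen_compl
  have hp1 : 1 < p := by linarith
  have hp0 : 0 < p := by linarith
  have hpq : p.HolderConjugate p.conjExponent := Real.HolderConjugate.conjExponent hp1
  obtain ⟨C, hC, hgrowth⟩ := hA.exists_norm_le hp2
  obtain ⟨Mu, hMu⟩ := hu_bdd
  obtain ⟨Mv, hMv⟩ := hv_bdd
  obtain ⟨Ru, hRu⟩ := exists_integrableOn_norm_gradient_rpow hp2 hpn hK hA hu hMu hf₁ hGu hGup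
    hu_sol
  obtain ⟨Rv, hRv⟩ := exists_integrableOn_norm_gradient_rpow hp2 hpn hK hA hv hMv hf₂ hGv hGvp
    hv_sol
  obtain ⟨RK, hRK⟩ := hK.isBounded.subset_ball (0 : 𝔼)
  set g : 𝔼 → ℝ := fun x => ‖Gu x‖ ^ p + ‖Gv x‖ ^ p with hg
  have hgI : IntegrableOn g {x | max Ru Rv ≤ ‖x‖} volume := by
    have hsu : {x : 𝔼 | max Ru Rv ≤ ‖x‖} ⊆ {x | Ru ≤ ‖x‖} := fun x hx =>
      (le_max_left Ru Rv).trans hx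
    have hsv : {x : 𝔼 | max Ru Rv ≤ ‖x‖} ⊆ {x | Rv ≤ ‖x‖} := fun x hx =>
      (le_max_right Ru Rv).trans hx
    exact (hRu.mono_set hsu).add (hRv.mono_set hsv)
  have hBu := hA.memLpLoc hp2 hKo hpq hGu.locallyIntegrable_grad.aestronglyMeasurable hGup
  have hBv := hA.memLpLoc hp2 hKo hpq hGv.locallyIntegrable_grad.aestronglyMeasurable hGvp
  have hGw := hGu.sub hGv
  have hGwp : MemLpLoc Kᶜ p (fun x => Gu x - Gv x) := fun S hS hSK =>
    (hGup S hS hSK).sub (hGvp S hS hSK)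
  have hw : ContinuousOn (fun x => u x - v x) Kᶜ := hu.sub hv
  set N := ∫ x : 𝔼, ‖∇ (unitBump n) x‖ ^ p with hN
  set Q : 𝔼 → ℝ := fun x =>
    deriv h (u x - v x) * inner ℝ (A x (Gu x) - A x (Gv x)) (Gu x - Gv x) with hQ
  have hinner0 : ∀ x ∈ Kᶜ, 0 ≤ inner ℝ (A x (Gu x) - A x (Gv x)) (Gu x - Gv x) := by
    intro x hx
    rcases eq_or_ne (Gv x) (Gu x) with he | he
    · simp [he]
    · exact (hA.inner_sub_pos hp2 hx he).le
  have hQ0 : ∀ x ∈ Kᶜ, 0 ≤ Q x := fun x hx => mul_nonneg hmono.deriv_nonneg (hinner0 x hx)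
  have htest : ∀ R, 0 < R → IsTestFunction Kᶜ (fun x => cutoff R x * ζ x) := fun R hR =>
    isTestFunction_mul (contDiff_cutoff R) (hasCompactSupport_cutoff hR) hζ hζK
  have hTu := fun R (hR : 0 < R) => testing_with_comp_mul hKo hpq hBu
    (locallyIntegrableOn_compl hK.isClosed hf₁) hu_sol hw hGw hGwp hh (htest R hR)
  have hTv := fun R (hR : 0 < R) => testing_with_comp_mul hKo hpq hBv
    (locallyIntegrableOn_compl hK.isClosed hf₂) hv_sol hw hGw hGwp hh (htest R hR)
  have hQeq : ∀ R, (fun x => cutoff R x * ζ x * Q x) =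
      (fun x => cutoff R x * ζ x * deriv h (u x - v x) * inner ℝ (A x (Gu x)) (Gu x - Gv x)) -
      (fun x => cutoff R x * ζ x * deriv h (u x - v x) *
        inner ℝ (A x (Gv x)) (Gu x - Gv x)) := fun R => by
    ext x
    simp only [hQ, Pi.sub_apply, inner_sub_left]
    ring
  have hQI : ∀ R, 0 < R → IntegrableOn (fun x => cutoff R x * ζ x * Q x) Kᶜ volume :=
    fun R hR => by
      rw [hQeq]
      exact (hTu R hR).1.sub (hTv R hR).1
  have hcutI : ∀ R, 0 < R → Integrable (fun x : 𝔼 => ‖∇ (cutoff R) x‖ ^ p) volume := fun R hR =>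
    integrable_norm_gradient_rpow (contDiff_cutoff R) (hasCompactSupport_cutoff hR) hp0
  -- energy bound on large balls
  have hbound : ∀ δ : ℝ, 0 < δ → ∀ k : ℕ, 1 ≤ (k : ℝ) → max Ru Rv ≤ k → RK ≤ k →
      ∫ x in Kᶜ, cutoff k x * ζ x * Q x ≤
        C * δ * (∫ x in {x : 𝔼 | (k : ℝ) ≤ ‖x‖}, g x) + 2 * C * δ ^ (1 - p) * N := by
    intro δ hδ k hk1 hkR hkK
    have hk0 : (0 : ℝ) < k := by linarith
    obtain ⟨hu1, hu2, hu3, hu4⟩ := hTu k hk0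
    obtain ⟨hv1, hv2, hv3, hv4⟩ := hTv k hk0
    -- The only use of `f₁ ≤ f₂`: the tested right-hand sides are ordered because the test function
    -- is nonnegative.
    have hfle : ∫ x in Kᶜ, h (u x - v x) * (cutoff k x * ζ x) * f₁ x ≤
        ∫ x in Kᶜ, h (u x - v x) * (cutoff k x * ζ x) * f₂ x := by
      refine integral_mono_ae hu3 hv3 ?_
      filter_upwards [hf] with x hx
      exact mul_le_mul_of_nonneg_left hx (mul_nonneg (hh0 _)
        (mul_nonneg (cutoff_nonneg _ _) (hζ0 x)))
    set T := {x : 𝔼 | (k : ℝ) ≤ ‖x‖} with hT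
    have hTm : MeasurableSet T := (isClosed_le continuous_const continuous_norm).measurableSet
    have hTK : T ⊆ Kᶜ := fun x hx hxK => by
      have h1 := mem_ball_zero_iff.1 (hRK hxK)
      have h2 : (k : ℝ) ≤ ‖x‖ := hx
      linarith
    have hgT : IntegrableOn g T volume := hgI.mono_set fun x hx => hkR.trans hx
    have hgTi : Integrable (T.indicator g) volume := hgT.integrable_indicator hTm
    -- Where `h (u - v)` is nonzero, `ζ` is locally `1`, so only `∇ (cutoff k)` remains, and it
    -- vanishes inside the ball of radius `k`. Hence only the energy on `T` enters.
    have hcross : (∫ x in Kᶜ, h (u x - v x) *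
          inner ℝ (A x (Gv x)) (∇ (fun x => cutoff k x * ζ x) x)) -
        (∫ x in Kᶜ, h (u x - v x) * inner ℝ (A x (Gu x)) (∇ (fun x => cutoff k x * ζ x) x)) ≤
        ∫ x in Kᶜ, (C * δ * T.indicator g x +
          2 * C * δ ^ (1 - p) * ‖∇ (cutoff k) x‖ ^ p) := by
      rw [← integral_sub hv2 hu2]
      refine setIntegral_mono_on (hv2.sub hu2) ((hgTi.integrableOn.const_mul _).add
        ((hcutI k hk0).integrableOn.const_mul _)) hKo.measurableSet fun x hx => ?_
      have hg0 : 0 ≤ T.indicator g x := indicator_nonneg (fun x _ => by positivity) x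
      have hRHS : 0 ≤ C * δ * T.indicator g x +
          2 * C * δ ^ (1 - p) * ‖∇ (cutoff k) x‖ ^ p := by positivity
      by_cases hz : h (u x - v x) = 0
      · simpa [hz] using hRHS
      rw [gradient_mul_eq_of_eventuallyEq_one (hζ1 x hx (Or.inl hz))]
      by_cases hxT : x ∈ T
      · rw [indicator_of_mem hxT]
        have hin : ∀ G : 𝔼, |h (u x - v x) * inner ℝ (A x G) (∇ (cutoff (k : ℝ)) x)| ≤
            C * (δ * ‖G‖ ^ p + δ ^ (1 - p) * ‖∇ (cutoff (k : ℝ)) x‖ ^ p) := by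
          intro G
          rw [abs_mul, abs_of_nonneg (hh0 _)]
          calc _ ≤ 1 * (‖A x G‖ * ‖∇ (cutoff (k : ℝ)) x‖) :=
                mul_le_mul (hh1 _) (abs_real_inner_le_norm _ _) (abs_nonneg _) zero_le_one
            _ ≤ C * ‖G‖ ^ (p - 1) * ‖∇ (cutoff (k : ℝ)) x‖ := by
                rw [one_mul]
                gcongr
                exact hgrowth x hx G
            _ = C * (‖G‖ ^ (p - 1) * ‖∇ (cutoff (k : ℝ)) x‖) := by ring
            _ ≤ _ := by
                gcongr
                exact rpow_mul_le_add hp1 (norm_nonneg _) (norm_nonneg _) hδ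
        have h1 := (abs_le.1 (hin (Gv x))).2
        have h2 := (abs_le.1 (hin (Gu x))).1
        simp only [hg]
        linarith
      · rw [gradient_cutoff_eq_zero hk0 (not_le.1 hxT)] at hRHS ⊢
        simpa using hRHS
    have hsum : ∫ x in Kᶜ, (C * δ * T.indicator g x +
          2 * C * δ ^ (1 - p) * ‖∇ (cutoff k) x‖ ^ p) ≤
        C * δ * (∫ x in T, g x) + 2 * C * δ ^ (1 - p) * N := by
      rw [integral_add (hgTi.integrableOn.const_mul _) ((hcutI k hk0).integrableOn.const_mul _),
        integral_const_mul, integral_const_mul, setIntegral_indicator hTm,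
        inter_eq_self_of_subset_right hTK]
      have hcN : ∫ x in Kᶜ, ‖∇ (cutoff (k : ℝ)) x‖ ^ p ≤ N :=
        (setIntegral_le_integral (hcutI k hk0) (Eventually.of_forall fun x => by
          simp only [Pi.zero_apply]; positivity)).trans (integral_norm_gradient_cutoff_le hpn hk1)
      gcongr
    rw [hQeq, integral_sub' hu1 hv1]
    linarith
  have hlim : ∀ r : ℕ, 0 < r → ∫ x in Kᶜ, cutoff r x * ζ x * Q x ≤ 0 := by
    intro r hr
    have hr0 : (0 : ℝ) < r := by exact_mod_cast hr
    -- Since `Q ≥ 0` on `Kᶜ` and `cutoff r ≤ cutoff k` for `k ≥ 2 * r`, the radius on the left can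
    -- be frozen while `k → ∞`.
    have hmonoR : ∀ k : ℕ, 2 * r ≤ k → ∫ x in Kᶜ, cutoff r x * ζ x * Q x ≤
        ∫ x in Kᶜ, cutoff k x * ζ x * Q x := by
      intro k hk
      have hk' : 2 * (r : ℝ) ≤ k := by exact_mod_cast hk
      refine setIntegral_mono_on (hQI r hr0) (hQI k (by linarith)) hKo.measurableSet
        fun x hx => ?_
      have hle : cutoff (r : ℝ) x ≤ cutoff k x := by
        rcases le_total ‖x‖ k with hxk | hxk
        · rw [cutoff_eq_one (by linarith) hxk]; exact cutoff_le_one _ _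
        · rw [cutoff_eq_zero hr0 (hk'.trans hxk)]; exact cutoff_nonneg _ _
      have := hζ0 x
      have := hQ0 x hx
      gcongr
    -- With `δ` fixed, `k → ∞` removes the tail of the energy.
    have hδ : ∀ δ : ℝ, 0 < δ → ∫ x in Kᶜ, cutoff r x * ζ x * Q x ≤
        2 * C * δ ^ (1 - p) * N := by
      intro δ hδ
      have hTd : Tendsto (fun k : ℕ => C * δ * (∫ x in {x : 𝔼 | (k : ℝ) ≤ ‖x‖}, g x) +
          2 * C * δ ^ (1 - p) * N) atTop (𝓝 (C * δ * 0 + 2 * C * δ ^ (1 - p) * N)) :=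
        ((tendsto_setIntegral_norm_ge hgI).const_mul _).add tendsto_const_nhds
      rw [mul_zero, zero_add] at hTd
      refine ge_of_tendsto hTd ?_
      have hge : ∀ a : ℝ, ∀ᶠ k : ℕ in atTop, a ≤ k := fun a =>
        tendsto_natCast_atTop_atTop.eventually_ge_atTop a
      filter_upwards [eventually_ge_atTop (2 * r), hge 1, hge (max Ru Rv), hge RK]
        with k h1 h2 h3 h4
      exact (hmonoR k h1).trans (hbound δ hδ k h2 h3 h4)
    -- The remaining term tends to zero as `δ → ∞`, because `1 - p < 0`.
    have hTδ : Tendsto (fun δ : ℝ => 2 * C * δ ^ (1 - p) * N) atTop (𝓝 0) := by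
      have h1 := tendsto_rpow_neg_atTop (show 0 < p - 1 by linarith)
      have h2 := (h1.const_mul (2 * C)).mul_const N
      simpa [neg_sub] using h2
    refine ge_of_tendsto hTδ ?_
    filter_upwards [eventually_gt_atTop 0] with δ h0 using hδ δ h0
  have hae : ∀ᵐ x ∂volume.restrict Kᶜ, ∀ r : ℕ, 0 < r → cutoff r x * ζ x * Q x = 0 := by
    rw [ae_all_iff]
    intro r
    by_cases hr : 0 < r
    · have hr0 : (0 : ℝ) < r := by exact_mod_cast hr
      have hnn : 0 ≤ᵐ[volume.restrict Kᶜ] fun x => cutoff r x * ζ x * Q x :=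
        (ae_restrict_iff' hKo.measurableSet).2 (Eventually.of_forall fun x hx =>
          mul_nonneg (mul_nonneg (cutoff_nonneg _ _) (hζ0 x)) (hQ0 x hx))
      have h0 := (setIntegral_eq_zero_iff_of_nonneg_ae hnn (hQI r hr0)).1
        (le_antisymm (hlim r hr) (integral_nonneg_of_ae hnn))
      filter_upwards [h0] with x hx _ using hx
    · exact Eventually.of_forall fun x h => absurd h hr
  filter_upwards [hae, ae_restrict_mem hKo.measurableSet] with x hx hxK
  by_cases hd : deriv h (u x - v x) = 0
  · simp [hd]
  obtain ⟨r, hr⟩ := exists_nat_ge ‖x‖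
  -- The shift to `r + 1` keeps the radius positive even when `x = 0`.
  have h1 := hx (r + 1) r.succ_pos
  rw [cutoff_eq_one (by positivity) (by push_cast; linarith),
    (hζ1 x hxK (Or.inr hd)).eq_of_nhds, one_mul, one_mul] at h1
  have h2 := (mul_eq_zero.1 h1).resolve_left hd
  have h3 : Gv x = Gu x := by
    by_contra he
    exact (hA.inner_sub_pos hp2 hxK he).ne' h2
  simp [h3]

end Comparison

end ExteriorComparison

/-! ### The comparison principle -/

open ExteriorComparison Filter Topology in
theorem corollary4p8 {n : ℕ} (hn : 2 ≤ n) {p : ℝ} (hp : (n : ℝ) ≤ p)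
    {K : Set (EuclideanSpace ℝ (Fin n))} (hK : IsCompact K) (hK_ne : K.Nonempty)
    {A : EuclideanSpace ℝ (Fin n) → EuclideanSpace ℝ (Fin n) → EuclideanSpace ℝ (Fin n)}
    (hA : ExteriorComparison.StructureConditions K p A)
    {u v f₁ f₂ : EuclideanSpace ℝ (Fin n) → ℝ}
    (hu_cont : ContinuousOn u (closure Kᶜ)) (hv_cont : ContinuousOn v (closure Kᶜ))
    (hu_bdd : ∃ M : ℝ, ∀ x ∈ Kᶜ, |u x| ≤ M) (hv_bdd : ∃ M : ℝ, ∀ x ∈ Kᶜ, |v x| ≤ M)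
    (hu_sob : ExteriorComparison.MemW1pLoc Kᶜ p u)
    (hv_sob : ExteriorComparison.MemW1pLoc Kᶜ p v)
    (hf₁ : ∀ U : Set (EuclideanSpace ℝ (Fin n)), IsOpen U → K ⊆ U →
      MeasureTheory.IntegrableOn f₁ Uᶜ MeasureTheory.volume)
    (hf₂ : ∀ U : Set (EuclideanSpace ℝ (Fin n)), IsOpen U → K ⊆ U →
      MeasureTheory.IntegrableOn f₂ Uᶜ MeasureTheory.volume)
    (hf : ∀ᵐ x ∂(MeasureTheory.volume.restrict Kᶜ), f₁ x ≤ f₂ x)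
    (hu_sol : ExteriorComparison.IsWeakSolution Kᶜ A u f₁)
    (hv_sol : ExteriorComparison.IsWeakSolution Kᶜ A v f₂)
    (h_bdry : ∀ x ∈ frontier K, u x ≤ v x) :
    ∀ x ∈ Kᶜ, u x ≤ v x := by
  have hp2 : 2 ≤ p := le_trans (by exact_mod_cast hn) hp
  have hKo : IsOpen Kᶜ := hK.isClosed.isOpen_compl
  obtain ⟨-, Gu', hGu', hGup'⟩ := hu_sob
  obtain ⟨-, Gv', hGv', hGvp'⟩ := hv_sob
  obtain ⟨Gu, hGu, hu_eq⟩ := hu_sol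
  obtain ⟨Gv, hGv, hv_eq⟩ := hv_sol
  -- The gradients in the Sobolev condition and in the equation are chosen separately; uniqueness
  -- almost everywhere transfers the integrability.
  have hGup : MemLpLoc Kᶜ p Gu := hGup'.congr_ae (hGu'.ae_eq hKo hGu)
  have hGvp : MemLpLoc Kᶜ p Gv := hGvp'.congr_ae (hGv'.ae_eq hKo hGv)
  have hu := hu_cont.mono subset_closure
  have hv := hv_cont.mono subset_closure
  by_contra! hcon
  obtain ⟨x₀, hx₀, hlt⟩ := hcon
  obtain ⟨ε, hε, hεx⟩ : ∃ ε, 0 < ε ∧ ε < u x₀ - v x₀ :=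
    ⟨(u x₀ - v x₀) / 2, by linarith, by linarith⟩
  -- Continuity up to the boundary makes `S` closed in the whole space, and the boundary inequality
  -- then keeps it off `K`.
  set S := closure Kᶜ ∩ (fun x => u x - v x) ⁻¹' Ici ε with hS
  have hSc : IsClosed S :=
    (hu_cont.sub hv_cont).preimage_isClosed_of_isClosed isClosed_closure isClosed_Ici
  have hSK : Disjoint K S := by
    refine disjoint_left.2 fun x hxK hxS => ?_
    have hfr : x ∈ frontier K := by
      rw [frontier_eq_closure_inter_closure]
      exact ⟨subset_closure hxK, hxS.1⟩
    have h1 := h_bdry x hfr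
    have h2 : ε ≤ u x - v x := hxS.2
    linarith
  obtain ⟨ζ, hζ, hζ0, hζK, hζS⟩ := exists_smooth_separation hK.isClosed hSc hSK
  -- `exp (-1 / (t - ε))` for `t > ε` and zero otherwise: smooth, monotone, bounded by `1`, and
  -- positive exactly beyond `ε`.
  set h : ℝ → ℝ := fun t => expNegInvGlue (t - ε) with hh
  have hhs : ContDiff ℝ ∞ h := expNegInvGlue.contDiff.comp (contDiff_id.sub contDiff_const)
  have hhmono : Monotone h := fun s t hst => expNegInvGlue.monotone (by linarith)
  have hh0 : ∀ t, 0 ≤ h t := fun t => expNegInvGlue.nonneg _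
  have hh1 : ∀ t, h t ≤ 1 := fun t => by
    simp only [hh, expNegInvGlue]
    split_ifs with hle
    · exact zero_le_one
    · exact Real.exp_le_one_iff.2 (neg_nonpos.2 (inv_nonneg.2 (not_le.1 hle).le))
  have hhz : ∀ t, t < ε → h t = 0 := fun t ht =>
    expNegInvGlue.zero_of_nonpos (by linarith)
  have hζ1 : ∀ x ∈ Kᶜ, h (u x - v x) ≠ 0 ∨ deriv h (u x - v x) ≠ 0 →
      ζ =ᶠ[𝓝 x] fun _ => 1 := by
    intro x hx hne
    refine hζS x ⟨subset_closure hx, ?_⟩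
    by_contra hnot
    have hlt : u x - v x < ε := not_le.1 hnot
    rcases hne with hne | hne
    · exact hne (hhz _ hlt)
    · have hev : h =ᶠ[𝓝 (u x - v x)] fun _ => 0 := by
        filter_upwards [Iio_mem_nhds hlt] with t ht using hhz t ht
      exact hne (by rw [hev.deriv_eq]; simp)
  have hzero := ae_deriv_smul_sub_eq_zero hp2 hp hK hA hu hv hu_bdd hv_bdd hf₁ hf₂ hf hGu hGv
    hGup hGvp (fun φ hφ => (hu_eq φ hφ).2.2) (fun φ hφ => (hv_eq φ hφ).2.2) hhs hhmono hh0 hh1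
    hζ hζ0 hζK hζ1
  set H : EuclideanSpace ℝ (Fin n) → ℝ := Kᶜ.indicator fun x => h (u x - v x) with hH
  -- At points of `K` continuity holds because the complement of `S` is a neighbourhood on which `H`
  -- vanishes.
  have hHc : Continuous H := by
    rw [continuous_iff_continuousAt]
    intro x
    by_cases hx : x ∈ Kᶜ
    · have hev : H =ᶠ[𝓝 x] fun x => h (u x - v x) := by
        filter_upwards [hKo.mem_nhds hx] with y hy using indicator_of_mem hy _
      refine ContinuousAt.congr ?_ hev.symm
      exact (hhs.continuous.comp_continuousOn (hu.sub hv)).continuousAt (hKo.mem_nhds hx)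
    · have hxS : x ∉ S := fun hxS => disjoint_left.1 hSK (notMem_compl_iff.1 hx) hxS
      have hev : H =ᶠ[𝓝 x] fun _ => 0 := by
        filter_upwards [hSc.isOpen_compl.mem_nhds hxS] with y hy
        by_cases hyK : y ∈ Kᶜ
        · rw [hH, indicator_of_mem hyK]
          exact hhz _ (not_le.1 fun hle => hy ⟨subset_closure hyK, hle⟩)
        · exact indicator_of_notMem hyK _
      exact continuousAt_const.congr hev.symm
  -- A test function `φ` on the whole space is replaced by `φ * ζ`, admissible in `Kᶜ`; the integral
  -- is unchanged because `ζ` is locally `1` wherever `H` is nonzero.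
  have hHzero : ∀ φ, IsTestFunction univ φ → ∀ e, ∫ x, H x * inner ℝ e (∇ φ x) = 0 := by
    intro φ hφ e
    rw [← setIntegral_comp_smul_gradient_eq_zero hKo (by linarith : 1 < p) (hu.sub hv)
      (hGu.sub hGv) (fun C hC hCK => (hGup C hC hCK).sub (hGvp C hC hCK)) hhs hzero
      (isTestFunction_mul hφ.smooth hφ.compact_support hζ hζK) e,
      ← setIntegral_eq_integral_of_forall_compl_eq_zero (s := Kᶜ)
        (fun x hx => by rw [hH, indicator_of_notMem hx, zero_mul])]
    refine setIntegral_congr_fun hKo.measurableSet fun x hx => ?_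
    simp only [hH, indicator_of_mem hx, Pi.sub_apply]
    by_cases hz : h (u x - v x) = 0
    · rw [hz, zero_mul, zero_mul]
    · rw [gradient_mul_eq_of_eventuallyEq_one (hζ1 x hx (Or.inl hz))]
  -- A point of `K` is where the constant function `H` is known to be zero.
  obtain ⟨k, hk⟩ := hK_ne
  have hfin := eq_of_distributional_gradient_eq_zero hHc hHzero x₀ k
  rw [hH, indicator_of_mem hx₀, indicator_of_notMem (notMem_compl_iff.2 hk)] at hfin
  exact (expNegInvGlue.pos_of_pos (by linarith : 0 < u x₀ - v x₀ - ε)).ne' hfin
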